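/- A turn sequence is a finite word $\sigma=\sigma_1\cdots\sigma_n$ ($n\ge 0$) over $\{\texttt{L},\texttt{R}\}$. A rectilinear chain realizes $\sigma$ if it starts at the origin $o$, has $n+1$ segments of positive integer length, its first segment heads east, its successive $90^\circ$ turns are $\sigma_1,\dots,\sigma_n$ ($\texttt{L}$ for left, $\texttt{R}$ for right), and it is simple (it does not touch or cross itself; in particular it is not closed). Let $A(\sigma)\subseteq\mathbb Z^2$ be the set of the endpoints of all chains that realize $\sigma$. For a point $p=(a,b)\in\mathbb Z^2$ let $$V^+(p)=\{(a+\mathrm{sgn}(a)\,i,\,j): i\in\mathbb Z_{\ge 0},\ j\in\mathbb Z\}\ (a\ne 0),\qquad H^+(p)=\{(i,\,b+\mathrm{sgn}(b)\,j): i\in\mathbb Z,\ j\in\mathbb Z_{\ge 0}\}\ (b\neq 0),$$ and $Q^+(p)=V^+(p)\cap H^+(p)$ $(a,b\ne 0)$. A staircase is a turn sequence in which left and right turns alternate. A hook of $\sigma$ is a pair of consecutive equal turns $\sigma_i=\sigma_{i+1}$; it is a right, left, up or down hook according to the direction (east, west, north, south) of the segment between these two turns. Let $(x^+_\sigma,0)$,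 $(x^-_\sigma,0)$, $(0,y^+_\sigma)$, $(0,y^-_\sigma)$ be the points of $A(\sigma)$ closest to $o$ on the positive $x$-axis, the negative $x$-axis, the positive $y$-axis and the negative $y$-axis (the origin excluded), respectively, if they exist. **Theorem.** For every turn sequence $\sigma$ of length $n\ge 0$, $$A(\sigma)=\begin{cases} \{(a,0): a\in\mathbb Z,\ a\ge 1\} & \text{if } n=0,\\ Q^+\big((1+\lfloor n/2\rfloor,\ \lceil n/2\rceil)\big) & \text{if } n\ge 1,\ \sigma\text{ is a staircase and }\sigma_1=\texttt{L},\\ Q^+\big((1+\lfloor n/2\rfloor,\ -\lceil n/2\rceil)\big) & \text{if } n\ge 1,\ \sigma\text{ is a staircase and }\sigma_1=\texttt{R},\\ \displaystyle\bigcup_{a\in\{x^+_\sigma,x^-_\sigma\}}V^+((a,0))\ \cup\bigcup_{b\in\{y^+_\sigma,y^-_\sigma\}}H^+((0,b)) & \text{otherwise,} \end{cases}$$ where the unions are over those of $x^\pm_\sigma$, $y^\pm_\sigma$ that exist. Moreover, if $n\ge 1$, then $x^+_\sigma$, $x^-_\sigma$, $y^+_\sigma$ and $y^-_\sigma$ exist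 if and only if $\sigma$ has a right, left, up and down hook, respectively. -/

import Mathlib

namespace TurnSeq

/-- A left or a right turn (by 90 degrees). -/
inductive Turn where
  | L
  | R

/-- Turning a heading by 90 degrees: `L` is counterclockwise, `R` is clockwise. -/
def Turn.apply : ℤ × ℤ → Turn → ℤ × ℤ
  | d, Turn.L => (-d.2, d.1)
  | d, Turn.R => (d.2, -d.1)

/-- The heading, after the turns in `u`, of a turtle that initially heads to the east. -/
def heading (u : List Turn) : ℤ × ℤ :=
  u.foldl Turn.apply (1, 0)

/-- The inclusion of the integer grid into the plane. -/
noncomputable def toPlane (p : ℤ × ℤ) : ℝ × ℝ :=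
  ((p.1 : ℝ), (p.2 : ℝ))

/-- The `i`-th segment (a closed segment of the plane) of the chain with vertices
`C 0, C 1, C 2, …`. -/
def seg (C : ℕ → ℤ × ℤ) (i : ℕ) : Set (ℝ × ℝ) :=
  segment ℝ (toPlane (C i)) (toPlane (C (i + 1)))

/-- The chain with the vertices `C 0, …, C (n + 1)`, where `n = σ.length`, realizes `σ`.
(The values `C k` for `k > n + 1` play no role.) -/
structure Realizes (σ : List Turn) (C : ℕ → ℤ × ℤ) : Prop where
  /-- The chain starts from the origin. -/
  start : C 0 = (0, 0)
  /-- Segment `i` has positive integral length, and its direction is the one that results from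
  heading to the east at first and making the first `i` turns of `σ`. -/
  step : ∀ i ≤ σ.length, ∃ l : ℕ, 0 < l ∧ C (i + 1) = C i + (l : ℤ) • heading (σ.take i)
  /-- The chain is simple: two distinct segments meet at most in the vertex that they share if
  they are consecutive. -/
  simple : ∀ i j, i < j → j ≤ σ.length → ∀ x ∈ seg C i ∩ seg C j, j = i + 1 ∧ x = toPlane (C j)

/-- The set `A(σ)` of the points that are reachable by `σ`. -/
def reachable (σ : List Turn) : Set (ℤ × ℤ) :=
  {p | ∃ C : ℕ → ℤ × ℤ, Realizes σ C ∧ C (σ.length + 1) = p}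

/-- The halfplane `V⁺(p)` (used only if the first coordinate of `p` is not zero). -/
def VPlus (p : ℤ × ℤ) : Set (ℤ × ℤ) :=
  {q | ∃ (i : ℕ) (j : ℤ), q = (p.1 + p.1.sign * (i : ℤ), j)}

/-- The halfplane `H⁺(p)` (used only if the second coordinate of `p` is not zero). -/
def HPlus (p : ℤ × ℤ) : Set (ℤ × ℤ) :=
  {q | ∃ (i : ℤ) (j : ℕ), q = (i, p.2 + p.2.sign * (j : ℤ))}

/-- The quadrant `Q⁺(p)`. -/
def QPlus (p : ℤ × ℤ) : Set (ℤ × ℤ) :=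
  VPlus p ∩ HPlus p

/-- A staircase: the turns alternate. -/
def IsStaircase (σ : List Turn) : Prop :=
  σ.IsChain (fun s t => s ≠ t)

/-- `σ` has a hook (two consecutive equal turns) whose middle segment, the one between
the two turns, has direction `d`. -/
def HasHook (σ : List Turn) (d : ℤ × ℤ) : Prop :=
  ∃ (u v : List Turn) (t : Turn), σ = u ++ t :: t :: v ∧ heading (u ++ [t]) = d

def HasRightHook (σ : List Turn) : Prop := HasHook σ (1, 0)
def HasLeftHook (σ : List Turn) : Prop := HasHook σ (-1, 0)
def HasUpHook (σ : List Turn) : Prop := HasHook σ (0, 1)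
def HasDownHook (σ : List Turn) : Prop := HasHook σ (0, -1)

/-- `(a, 0)` is the reachable point closest to the origin on the positive x-axis. -/
def IsXPlus (σ : List Turn) (a : ℤ) : Prop :=
  IsLeast {c : ℤ | 0 < c ∧ (c, 0) ∈ reachable σ} a

/-- `(a, 0)` is the reachable point closest to the origin on the negative x-axis. -/
def IsXMinus (σ : List Turn) (a : ℤ) : Prop :=
  IsGreatest {c : ℤ | c < 0 ∧ (c, 0) ∈ reachable σ} a

/-- `(0, b)` is the reachable point closest to the origin on the positive y-axis. -/
def IsYPlus (σ : List Turn) (b : ℤ) : Prop :=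
  IsLeast {c : ℤ | 0 < c ∧ (0, c) ∈ reachable σ} b

/-- `(0, b)` is the reachable point closest to the origin on the negative y-axis. -/
def IsYMinus (σ : List Turn) (b : ℤ) : Prop :=
  IsGreatest {c : ℤ | c < 0 ∧ (0, c) ∈ reachable σ} b

end TurnSeq

open TurnSeq

/-!
A simple chain stays simple under every vertical deformation that preserves the vertical order of
the segments that lie above one another, and likewise horizontally. Hence a positive coordinate of
the endpoint can be enlarged at will, and if `(a, 0)` is reachable, then so is the whole line
`x = a`. It remains to find the reachable points on the axes, and to show that, in the presence of a
hook, the projection of every reachable point off the axes to one of the axes is reachable.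

A right hook alone reaches a point on the positive `x`-axis, and every further segment, at either
end, can be added after a deformation that clears its way. Conversely, without right hooks a chain
revisits a horizontal strip only further to the west, and therefore cannot end to the east of the
origin on the `x`-axis.

For the projection, let the endpoint lie in the first quadrant and let the first segment be
vertical. If it goes up, then after a reversal of the chain the last segment does, and it can be
removed, which is an induction step. If it goes down, then consider what prevents the endpoint from
being lowered to the `x`-axis: a path of free upward moves and of moves along horizontal segments of
the chain. The corresponding path that prevents the endpoint from being moved to the `y`-axis would
have to cross it, and this would force a branching point of the chain, so only one of them exists.

A chain of a staircase is monotone, so that the shortest one ends at the corner of the quadrant.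
-/

namespace TurnSeq

/-- The integer `b` lies between `p` and `q`, in either order. -/
abbrev Between (b p q : ℤ) : Prop := (p ≤ b ∧ b ≤ q) ∨ (q ≤ b ∧ b ≤ p)

/-- The interval between `p` and `q` is disjoint from the one between `r` and `s`. Both are spelled
out, and not written as `Set.uIcc`, in order to be accessible to linear arithmetic. -/
abbrev Separated (p q r s : ℤ) : Prop :=
  (p < r ∧ p < s ∧ q < r ∧ q < s) ∨ (r < p ∧ r < q ∧ s < p ∧ s < q)

/-- The sign of the increment `z (i + 1) - z i` is `w i`, for `i ≤ n`. -/
def Steps (n : ℕ) (w z : ℕ → ℤ) : Prop :=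
  ∀ i ≤ n, (w i = 0 ∧ z (i + 1) = z i) ∨ (w i = 1 ∧ z i < z (i + 1)) ∨
    (w i = -1 ∧ z (i + 1) < z i)

/-- The vectors `(u i, v i)`, for `i ≤ n`, are alternately horizontal and vertical unit vectors:
the directions of a rectilinear chain with `n` turns. -/
structure Dirs (n : ℕ) (u v : ℕ → ℤ) : Prop where
  dir : ∀ i ≤ n, (u i = 0 ∧ (v i = 1 ∨ v i = -1)) ∨ (v i = 0 ∧ (u i = 1 ∨ u i = -1))
  alt : ∀ i < n, (u i = 0 ↔ v (i + 1) = 0)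

/-- Nonadjacent segments of the chain with the vertices `(x k, y k)`, `k ≤ n + 1`, are disjoint. -/
def Apart (n : ℕ) (x y : ℕ → ℤ) : Prop :=
  ∀ i j, i + 1 < j → j ≤ n → Separated (x i) (x (i + 1)) (x j) (x (j + 1)) ∨
    Separated (y i) (y (i + 1)) (y j) (y (j + 1))

/-- The vertices `(x k, y k)`, `k ≤ n + 1`, form a simple chain that starts at the origin and whose
segments have the directions `(u i, v i)`. The two coordinates are kept apart since most arguments
modify only one of them. -/
structure GridChain (n : ℕ) (u v x y : ℕ → ℤ) : Prop where
  startX : x 0 = 0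
  startY : y 0 = 0
  stepX : Steps n u x
  stepY : Steps n v y
  apart : Apart n x y

/-- A simple chain with the directions `(u i, v i)` leads from the origin to `(a, b)`. -/
def Reach (n : ℕ) (u v : ℕ → ℤ) (a b : ℤ) : Prop :=
  ∃ x y, GridChain n u v x y ∧ x (n + 1) = a ∧ y (n + 1) = b

/-- The directions `w 0, …, w n` in reverse order. -/
def revDirs (n : ℕ) (w : ℕ → ℤ) (i : ℕ) : ℤ := w (n - i)

variable {m n : ℕ} {u v w x y z : ℕ → ℤ} {a b c : ℤ}

theorem Dirs.swap (h : Dirs n u v) : Dirs n v u where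
  dir i hi := (h.dir i hi).symm
  alt i hi := by grind [h.dir i hi.le, h.dir (i + 1) hi, h.alt i hi]

theorem Dirs.mono (h : Dirs n u v) (hm : m ≤ n) : Dirs m u v :=
  ⟨fun i hi => h.dir i (hi.trans hm), fun i hi => h.alt i (hi.trans_le hm)⟩

theorem Dirs.neg_left (h : Dirs n u v) : Dirs n (-u) v where
  dir i hi := by grind [h.dir i hi, Pi.neg_apply]
  alt i hi := by grind [h.alt i hi, Pi.neg_apply]

theorem Dirs.rev (h : Dirs n u v) : Dirs n (revDirs n u) (revDirs n v) where
  dir i _ := h.dir (n - i) (n.sub_le i)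
  alt i hi := by
    obtain ⟨k, rfl⟩ := Nat.exists_eq_add_of_lt hi
    have hk : i + k + 1 - i = k + 1 ∧ i + k + 1 - (i + 1) = k := by omega
    simpa only [revDirs, hk] using (h.swap.alt k (by omega)).symm

theorem Dirs.left_eq_zero_iff (h : Dirs n u v) {i : ℕ} (hi : i ≤ n) : u i = 0 ↔ v i ≠ 0 := by
  grind [h.dir i hi]

theorem Steps.eq (h : Steps n w z) {i : ℕ} (hi : i ≤ n) (hw : w i = 0) : z (i + 1) = z i := by
  grind [h i hi]

theorem Steps.ne (h : Steps n w z) {i : ℕ} (hi : i ≤ n) (hw : w i ≠ 0) : z (i + 1) ≠ z i := by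
  grind [h i hi]

theorem Steps.mono (h : Steps n w z) (hm : m ≤ n) : Steps m w z := fun i hi => h i (hi.trans hm)

theorem Steps.neg (h : Steps n w z) : Steps n (-w) (-z) := fun i hi => by
  grind [h i hi, Pi.neg_apply]

theorem Steps.rev (h : Steps n w z) :
    Steps n (revDirs n w) (fun k => z (n + 1) - z (n + 1 - k)) := fun i hi => by
  have hk : n + 1 - i = n - i + 1 ∧ n + 1 - (i + 1) = n - i := by omega
  simp only [revDirs, hk]
  grind [h (n - i) (n.sub_le i)]

theorem GridChain.swap (h : GridChain n u v x y) : GridChain n v u y x :=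
  ⟨h.startY, h.startX, h.stepY, h.stepX, fun i j hij hj => (h.apart i j hij hj).symm⟩

theorem GridChain.mono (h : GridChain n u v x y) (hm : m ≤ n) : GridChain m u v x y :=
  ⟨h.startX, h.startY, h.stepX.mono hm, h.stepY.mono hm,
    fun i j hij hj => h.apart i j hij (hj.trans hm)⟩

theorem GridChain.neg_left (h : GridChain n u v x y) : GridChain n (-u) v (-x) y where
  startX := by simp [h.startX]
  startY := h.startY
  stepX := h.stepX.neg
  stepY := h.stepY
  apart i j hij hj := by
    have := h.apart i j hij hj
    simp only [Pi.neg_apply]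
    omega

theorem GridChain.neg_right (h : GridChain n u v x y) : GridChain n u (-v) x (-y) :=
  h.swap.neg_left.swap

/-- Reversing a chain exchanges its ends and its directions; a point reflection of the plane
restores both. -/
theorem GridChain.rev (h : GridChain n u v x y) :
    GridChain n (revDirs n u) (revDirs n v) (fun k => x (n + 1) - x (n + 1 - k))
      (fun k => y (n + 1) - y (n + 1 - k)) where
  startX := by simp
  startY := by simp
  stepX := h.stepX.rev
  stepY := h.stepY.rev
  apart i j hij hj := by
    have hk : n + 1 - i = n - i + 1 ∧ n + 1 - (i + 1) = n - i ∧
      n + 1 - j = n - j + 1 ∧ n + 1 - (j + 1) = n - j := by omega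
    simp only [hk]
    have := h.apart (n - j) (n - i) (by omega) (n.sub_le i)
    omega

theorem Reach.congr {u' v' : ℕ → ℤ} (h : Reach n u v a b)
    (hu : ∀ i ≤ n, u' i = u i) (hv : ∀ i ≤ n, v' i = v i) : Reach n u' v' a b := by
  obtain ⟨x, y, hC, ha, hb⟩ := h
  refine ⟨x, y, ⟨hC.startX, hC.startY, fun i hi => ?_, fun i hi => ?_, hC.apart⟩, ha, hb⟩
  · exact hu i hi ▸ hC.stepX i hi
  · exact hv i hi ▸ hC.stepY i hi

theorem reach_swap_iff : Reach n v u b a ↔ Reach n u v a b :=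
  ⟨fun ⟨x, y, hC, hb, ha⟩ => ⟨y, x, hC.swap, ha, hb⟩,
    fun ⟨x, y, hC, ha, hb⟩ => ⟨y, x, hC.swap, hb, ha⟩⟩

theorem Reach.neg_left (h : Reach n u v a b) : Reach n (-u) v (-a) b := by
  obtain ⟨x, y, hC, rfl, rfl⟩ := h
  exact ⟨-x, y, hC.neg_left, rfl, rfl⟩

theorem reach_neg_left_iff : Reach n (-u) v (-a) b ↔ Reach n u v a b :=
  ⟨fun h => by simpa only [neg_neg] using h.neg_left, Reach.neg_left⟩

theorem reach_neg_right_iff : Reach n u (-v) a (-b) ↔ Reach n u v a b := by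
  rw [← reach_swap_iff, reach_neg_left_iff, reach_swap_iff]

theorem Reach.rev (h : Reach n u v a b) : Reach n (revDirs n u) (revDirs n v) a b := by
  obtain ⟨x, y, hC, rfl, rfl⟩ := h
  exact ⟨_, _, hC.rev, by simp [hC.startX], by simp [hC.startY]⟩

theorem reach_rev_iff : Reach n (revDirs n u) (revDirs n v) a b ↔ Reach n u v a b := by
  refine ⟨fun h => h.rev.congr (fun i hi => ?_) (fun i hi => ?_), Reach.rev⟩ <;>
    simp only [revDirs, Nat.sub_sub_self hi]

theorem GridChain.deform (h : GridChain n u v x y) (hz : z 0 = 0)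
    (heq : ∀ i ≤ n, y (i + 1) = y i → z (i + 1) = z i)
    (hlt : ∀ i ≤ n, ∀ j ≤ n, ¬ Separated (x i) (x (i + 1)) (x j) (x (j + 1)) →
      ∀ k l, (k = i ∨ k = i + 1) → (l = j ∨ l = j + 1) → y k < y l → z k < z l) :
    GridChain n u v x z where
  startX := h.startX
  startY := hz
  stepX := h.stepX
  stepY i hi := by
    have hup := hlt i hi i hi (by omega) i (i + 1) (.inl rfl) (.inr rfl)
    have hdown := hlt i hi i hi (by omega) (i + 1) i (.inr rfl) (.inl rfl)
    exact (h.stepY i hi).imp (.imp_right (heq i hi)) (.imp (.imp_right hup) (.imp_right hdown))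
  apart i j hij hj := by
    refine or_iff_not_imp_left.2 fun hx => ?_
    have hij' := hlt i (by omega) j hj hx
    have hji' := hlt j hj i (by omega) (by omega)
    refine ((h.apart i j hij hj).resolve_left hx).imp ?_ ?_
    · exact fun ⟨h₁, h₂, h₃, h₄⟩ => ⟨hij' _ _ (.inl rfl) (.inl rfl) h₁,
        hij' _ _ (.inl rfl) (.inr rfl) h₂, hij' _ _ (.inr rfl) (.inl rfl) h₃,
        hij' _ _ (.inr rfl) (.inr rfl) h₄⟩
    · exact fun ⟨h₁, h₂, h₃, h₄⟩ => ⟨hji' _ _ (.inl rfl) (.inl rfl) h₁,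
        hji' _ _ (.inl rfl) (.inr rfl) h₂, hji' _ _ (.inr rfl) (.inl rfl) h₃,
        hji' _ _ (.inr rfl) (.inr rfl) h₄⟩

theorem GridChain.comp_strictMono (h : GridChain n u v x y) {f : ℤ → ℤ} (hf : StrictMono f)
    (h0 : f 0 = 0) : GridChain n u v x (f ∘ y) :=
  h.deform (by simp [h.startY, h0]) (fun i _ he => congrArg f he)
    fun _ _ _ _ _ _ _ _ _ hkl => hf hkl

theorem Reach.stretch (h : Reach n u v a b) (hb : 0 < b) (hbc : b ≤ c) : Reach n u v a c := by
  obtain ⟨x, y, hC, ha, hb'⟩ := h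
  have hf : StrictMono fun t : ℤ => if 0 < t then t + (c - b) else t := fun s t hst => by grind
  exact ⟨x, _, hC.comp_strictMono hf (if_neg (lt_irrefl 0)), ha, by simp [hb', hb]⟩

theorem Dirs.exists_last (hd : Dirs n u v) (hn : 1 ≤ n) :
    ∃ j ≤ n, n ≤ j + 1 ∧ v j ≠ 0 ∧
      ∀ x y, Steps n u x → Steps n v y → x j = x n ∧ y (j + 1) = y (n + 1) := by
  by_cases hv : v n = 0
  · obtain ⟨n, rfl⟩ := Nat.exists_eq_add_of_le' hn
    have hu : u n = 0 := (hd.alt n n.lt_succ_self).2 hv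
    exact ⟨n, n.le_succ, le_rfl, (hd.left_eq_zero_iff n.le_succ).1 hu, fun x y hx hy =>
      ⟨(hx.eq n.le_succ hu).symm, (hy.eq le_rfl hv).symm⟩⟩
  · exact ⟨n, le_rfl, n.le_succ, hv, fun _ _ _ _ => ⟨rfl, rfl⟩⟩

/-- The vertices at the end of the chain that lie on the axis are moved to the level `b`, the
rest of the chain being stretched in order to make room. -/
theorem GridChain.exists_level (hC : GridChain n u v x y) (hd : Dirs n u v) (hn : 1 ≤ n)
    (h0 : y (n + 1) = 0) (b : ℤ) :
    ∃ z, GridChain n u v x z ∧ z (n + 1) = b ∧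
      ∀ k ≤ n, (y k < 0 → z k < min 0 b) ∧ (0 < y k → max 0 b < z k) := by
  obtain ⟨j, hjn, hnj, hvj, hj⟩ := hd.exists_last hn
  have hlast := hC.stepY.ne hjn hvj
  let z : ℕ → ℤ := fun k => if j < k then b else (|b| + 1) * y k
  have hneg (k : ℕ) (hk : y k < 0) : (|b| + 1) * y k < min 0 b := by
    have := neg_abs_le b
    have := abs_nonneg b
    rw [lt_min_iff]
    constructor <;> nlinarith
  have hpos (k : ℕ) (hk : 0 < y k) : max 0 b < (|b| + 1) * y k := by
    have := le_abs_self b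
    have := abs_nonneg b
    rw [max_lt_iff]
    constructor <;> nlinarith
  have hzero (k : ℕ) (hk : j < k) (hkn : k ≤ n + 1) : y k = 0 := by
    obtain rfl | rfl : k = j + 1 ∨ k = n + 1 := by omega
    · rw [(hj x y hC.stepX hC.stepY).2, h0]
    · exact h0
  have hlt {k l : ℕ} (hk : k ≤ n + 1) (hl : l ≤ n + 1) (hkl : y k < y l) : z k < z l := by
    have : (|b| + 1) * y k < (|b| + 1) * y l := mul_lt_mul_of_pos_left hkl (by positivity)
    grind
  refine ⟨z, hC.deform (by grind [hC.startY]) (fun i hi he => by grind) ?_, if_pos (by omega), ?_⟩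
  · exact fun i hi j hj _ k l hk hl => hlt (by omega) (by omega)
  · exact fun k hk => ⟨by grind, by grind⟩

theorem Reach.of_axis (hd : Dirs n u v) (hn : 1 ≤ n) (h : Reach n u v a 0) (b : ℤ) :
    Reach n u v a b := by
  obtain ⟨x, y, hC, ha, h0⟩ := h
  obtain ⟨z, hz, hb, -⟩ := hC.exists_level hd hn h0 b
  exact ⟨x, z, hz, ha, hb⟩

theorem GridChain.extend (hC : GridChain n u v x y) (hu : u (n + 1) = 0)
    (hc : (v (n + 1) = 1 ∧ y (n + 1) < c) ∨ (v (n + 1) = -1 ∧ c < y (n + 1)))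
    (hsep : ∀ i < n, Separated (x i) (x (i + 1)) (x (n + 1)) (x (n + 1)) ∨
      Separated (y i) (y (i + 1)) (y (n + 1)) c) :
    Reach (n + 1) u v (x (n + 1)) c := by
  obtain ⟨x', hx', hx⟩ : ∃ x' : ℕ → ℤ, x' (n + 2) = x (n + 1) ∧ ∀ k ≤ n + 1, x' k = x k :=
    ⟨Function.update x (n + 2) (x (n + 1)), Function.update_self .., fun k hk =>
      Function.update_of_ne (by omega) ..⟩
  obtain ⟨y', hy', hy⟩ : ∃ y' : ℕ → ℤ, y' (n + 2) = c ∧ ∀ k ≤ n + 1, y' k = y k :=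
    ⟨Function.update y (n + 2) c, Function.update_self .., fun k hk =>
      Function.update_of_ne (by omega) ..⟩
  refine ⟨x', y', ⟨?_, ?_, fun i hi => ?_, fun i hi => ?_, fun i j hij hj => ?_⟩, hx', hy'⟩
  · rw [hx 0 (by omega), hC.startX]
  · rw [hy 0 (by omega), hC.startY]
  · rcases hi.lt_or_eq with hi | rfl
    · rw [hx i (by omega), hx (i + 1) (by omega)]
      exact hC.stepX i (by omega)
    · exact .inl ⟨hu, by rw [hx', hx _ le_rfl]⟩
  · rcases hi.lt_or_eq with hi | rfl
    · rw [hy i (by omega), hy (i + 1) (by omega)]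
      exact hC.stepY i (by omega)
    · rw [hy', hy _ le_rfl]
      exact .inr hc
  · rw [hx i (by omega), hx (i + 1) (by omega), hx j (by omega), hy i (by omega),
      hy (i + 1) (by omega), hy j (by omega)]
    rcases hj.lt_or_eq with hj | rfl
    · rw [hx (j + 1) (by omega), hy (j + 1) (by omega)]
      exact hC.apart i j hij (by omega)
    · rw [hx', hy']
      exact hsep i (by omega)

theorem GridChain.truncate (hC : GridChain (n + 1) u v x y) (hu : u (n + 1) = 0)
    (hv : v (n + 1) = 1) (hc : y (n + 1) < c) (hcb : c ≤ y (n + 2)) :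
    Reach (n + 1) u v (x (n + 2)) c := by
  have hx : x (n + 2) = x (n + 1) := hC.stepX.eq le_rfl hu
  rw [hx]
  refine (hC.mono n.le_succ).extend hu (.inl ⟨hv, hc⟩) fun i hi => ?_
  have := hC.apart i (n + 1) (by omega) le_rfl
  simp only [add_assoc, Nat.reduceAdd] at this
  omega

/-- The deformation `z` of the chain clears the way for the new segment. -/
theorem GridChain.append (hC : GridChain n u v x y) (hz : GridChain n u v x z)
    (hd : Dirs (n + 1) u v) (hu : u (n + 1) = 0)
    (hc : (v (n + 1) = 1 ∧ z (n + 1) < c) ∨ (v (n + 1) = -1 ∧ c < z (n + 1)))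
    (hlow : ∀ k ≤ n, y k < y (n + 1) → z k < z (n + 1) ∧ z k < c)
    (hhigh : ∀ k ≤ n, y (n + 1) < y k → z (n + 1) < z k ∧ c < z k) :
    Reach (n + 1) u v (x (n + 1)) c := by
  refine hz.extend hu hc fun i hi => ?_
  have hun : u n ≠ 0 := fun h => (hd.left_eq_zero_iff le_rfl).1 hu ((hd.alt n (by omega)).1 h)
  have hvn : v n = 0 := (hd.swap.left_eq_zero_iff (by omega)).2 hun
  have hy := hC.stepY.eq le_rfl hvn
  obtain rfl | hin : n = i + 1 ∨ i + 1 < n := by omega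
  · left
    have := hC.stepX.eq (by omega) ((hd.alt i (by omega)).2 hvn)
    have := hC.stepX (i + 1) le_rfl
    omega
  · rcases hC.apart i n hin le_rfl with hx | hy'
    · left
      omega
    · right
      have := hlow i (by omega)
      have := hlow (i + 1) (by omega)
      have := hhigh i (by omega)
      have := hhigh (i + 1) (by omega)
      omega

theorem Reach.append_axis (h : Reach n u v a 0) (hn : 1 ≤ n) (hd : Dirs (n + 1) u v)
    (hu : u (n + 1) = 0) : Reach (n + 1) u v a 0 := by
  obtain ⟨x, y, hC, rfl, h0⟩ := h
  obtain ⟨z, hz, hzn, hsign⟩ := hC.exists_level (hd.mono n.le_succ) hn h0 (-v (n + 1))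
  refine hC.append hz hd hu ?_ (fun k hk hlt => ?_) fun k hk hlt => ?_
  · have := hd.dir (n + 1) le_rfl
    omega
  · have := (hsign k hk).1 (h0 ▸ hlt)
    omega
  · have := (hsign k hk).2 (h0 ▸ hlt)
    omega

theorem Reach.append_up (h : Reach n u v a b) (hb : 0 ≤ b) (hd : Dirs (n + 1) u v)
    (hv : v (n + 1) = 1) (hbc : b < c) : Reach (n + 1) u v a c := by
  obtain ⟨x, y, hC, rfl, rfl⟩ := h
  let f : ℤ → ℤ := fun t => if y (n + 1) < t then t + (c - y (n + 1)) else t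
  have hle {t : ℤ} (ht : t ≤ y (n + 1)) : f t = t := if_neg ht.not_gt
  have hgt {t : ℤ} (ht : y (n + 1) < t) : f t = t + (c - y (n + 1)) := if_pos ht
  have hf : StrictMono f := fun s t hst => by grind
  refine hC.append (hC.comp_strictMono hf (hle hb)) hd ?_ (.inl ⟨hv, ?_⟩) (fun k _ hlt => ?_)
    fun k _ hlt => ?_
  · exact (hd.left_eq_zero_iff le_rfl).2 (by omega)
  · simpa only [Function.comp_apply, hle le_rfl]
  · simp only [Function.comp_apply, hle le_rfl, hle hlt.le]
    omega
  · simp only [Function.comp_apply, hle le_rfl, hgt hlt]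
    omega

theorem Reach.append_along (h : Reach n u v a b) (hb : 0 < b) (hd : Dirs (n + 1) u v)
    (hu : u (n + 1) = 0) : ∃ c, 0 < c ∧ Reach (n + 1) u v a c := by
  obtain ⟨x, y, hC, rfl, rfl⟩ := h
  have hz := hC.comp_strictMono (f := fun t => 2 * t) (fun s t hst => by grind) rfl
  have hv := (hd.dir (n + 1) le_rfl).resolve_right
    fun h => (hd.left_eq_zero_iff le_rfl).1 hu h.1
  refine ⟨2 * y (n + 1) + v (n + 1), by omega, hC.append hz hd hu ?_ (fun k _ _ => ?_)
    fun k _ _ => ?_⟩ <;> simp only [Function.comp_apply] <;> omega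

/-- Two opposite vertical directions are joined by an eastward one: a right hook. Hooks in the
other three directions are right hooks of the rotated or reflected sequence. -/
def RightHook (n : ℕ) (u v : ℕ → ℤ) : Prop :=
  ∃ i, i + 2 ≤ n ∧ v i = -v (i + 2) ∧ u (i + 1) = 1

theorem RightHook.of_neg_right (h : RightHook n u (-v)) : RightHook n u v := by
  obtain ⟨i, hi, hv, hu⟩ := h
  exact ⟨i, hi, neg_injective hv, hu⟩

theorem Dirs.tail (h : Dirs (n + 1) u v) : Dirs n (fun i => u (i + 1)) (fun i => v (i + 1)) :=
  ⟨fun i hi => h.dir (i + 1) (by omega), fun i hi => h.alt (i + 1) (by omega)⟩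

theorem reach_of_hook_two (hd : Dirs 2 u v) (hv : v 0 = -v 2) (hu : u 1 = 1) : Reach 2 u v 1 0 := by
  have hv1 : v 1 = 0 := (hd.swap.left_eq_zero_iff (by omega)).2 (by omega)
  have hu0 : u 0 = 0 := (hd.alt 0 (by omega)).2 hv1
  have hu2 : u 2 = 0 := (hd.swap.alt 1 (by omega)).1 hv1
  have hv0 := hd.dir 0 (by omega)
  refine ⟨fun k => if k ≤ 1 then 0 else 1, fun k => if k = 1 ∨ k = 2 then v 0 else 0,
    ⟨rfl, rfl, fun i hi => ?_, fun i hi => ?_, fun i j hij hj => ?_⟩, rfl, rfl⟩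
  · interval_cases i <;> simp [hu, hu0, hu2]
  · interval_cases i <;> simp <;> omega
  · obtain ⟨rfl, rfl⟩ : i = 0 ∧ j = 2 := by omega
    exact .inl (.inl (by simp))

theorem exists_reach_append (hd : Dirs (n + 1) u v) (hn : 1 ≤ n) (h : ∃ a > 0, Reach n u v a 0) :
    ∃ a > 0, Reach (n + 1) u v a 0 := by
  obtain ⟨a, ha, h⟩ := h
  by_cases hu : u (n + 1) = 0
  · exact ⟨a, ha, h.append_axis hn hd hu⟩
  · have hv : v (n + 1) = 0 := (hd.swap.left_eq_zero_iff le_rfl).2 hu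
    obtain ⟨c, hc, h'⟩ := (reach_swap_iff.2 h).append_along ha hd.swap hv
    exact ⟨c, hc, reach_swap_iff.1 h'⟩

theorem exists_reach_prepend (hd : Dirs (n + 1) u v) (hn : 1 ≤ n)
    (h : ∃ a > 0, Reach n (fun i => u (i + 1)) (fun i => v (i + 1)) a 0) :
    ∃ a > 0, Reach (n + 1) u v a 0 := by
  suffices h' : ∃ a > 0, Reach (n + 1) (revDirs (n + 1) u) (revDirs (n + 1) v) a 0 from
    h'.imp fun _ => And.imp_right reach_rev_iff.1
  refine exists_reach_append hd.rev hn ?_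
  obtain ⟨a, ha, h⟩ := h
  refine ⟨a, ha, h.rev.congr (fun i hi => ?_) (fun i hi => ?_)⟩ <;>
    simp only [revDirs, Nat.sub_add_comm hi]

theorem RightHook.exists_reach (hd : Dirs n u v) (h : RightHook n u v) :
    ∃ a > 0, Reach n u v a 0 := by
  obtain ⟨i, hi, hv, hu⟩ := h
  induction i generalizing n u v with
  | zero =>
    induction n, hi using Nat.le_induction with
    | base => exact ⟨1, one_pos, reach_of_hook_two hd hv hu⟩
    | succ n hn ih => exact exists_reach_append hd (by omega) (ih (hd.mono n.le_succ))
  | succ i ih =>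
    obtain ⟨n, rfl⟩ := Nat.exists_eq_add_of_le' (show 1 ≤ n by omega)
    exact exists_reach_prepend hd (by omega) (ih hd.tail (by omega) hv hu)

/-- Segment `i` crosses the horizontal strip between the levels `t` and `t + 1`. -/
abbrev Spans (y : ℕ → ℤ) (i : ℕ) (t : ℤ) : Prop :=
  Between t (y i) (y (i + 1)) ∧ Between (t + 1) (y i) (y (i + 1))

theorem Spans.neg {i : ℕ} {t : ℤ} (h : Spans y i t) : Spans (-y) i (-t - 1) := by
  simp only [Spans, Pi.neg_apply] at h ⊢
  omega

theorem Spans.right_ne_zero {i : ℕ} {t : ℤ} (h : Spans y i t) (hy : Steps n v y) (hi : i ≤ n) :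
    v i ≠ 0 := fun hv => by
  have := hy.eq hi hv
  omega

theorem lt_of_not_spans {i j : ℕ} {t : ℤ} (hi : t < y (i + 1))
    (h : ∀ k, i < k → k < j → ¬ Spans y k t) : ∀ k, i < k → k ≤ j → t < y k := fun k hik => by
  induction k, hik using Nat.le_induction with
  | base => exact fun _ => hi
  | succ k hk ih =>
    intro hkj
    have := h k hk hkj
    omega

theorem GridChain.not_between_of_crosses (hC : GridChain n u v x y) {k l : ℕ} (hk : k ≤ n)
    (hl : l ≤ n) (hkl : k + 1 < l ∨ l + 1 < k) (hlevel : y k = y (k + 1))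
    (hcross : Between (y k) (y l) (y (l + 1))) : ¬ Between (x l) (x k) (x (k + 1)) := by
  rcases hkl with hkl | hkl
  · have := hC.apart k l hkl hl
    omega
  · have := hC.apart l k hkl hk
    omega

theorem Spans.exists_next {i : ℕ} {t : ℤ} (h : Spans y i t) (hi : t < y (i + 1))
    (hi' : t < y (i + 3)) (heq : y (i + 2) = y (i + 1)) (hne : y (i + 3) ≠ y (i + 2)) :
    ∃ i', (i' = i ∧ y (i + 1) ≠ t + 1 ∨ i' = i + 2 ∧ y (i + 1) = t + 1) ∧ Spans y i' (t + 1) := by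
  by_cases hy : y (i + 1) = t + 1
  · refine ⟨i + 2, .inr ⟨rfl, hy⟩, ?_⟩
    simp only [Spans, add_assoc, Nat.reduceAdd]
    omega
  · exact ⟨i, .inl ⟨rfl, hy⟩, by omega⟩

theorem Spans.exists_prev {j : ℕ} {t : ℤ} (h : Spans y (j + 2) t) (hj : t < y (j + 2))
    (hj' : t < y j) (heq : y (j + 2) = y (j + 1)) (hne : y (j + 1) ≠ y j) :
    ∃ j', (j' = j + 2 ∧ y (j + 2) ≠ t + 1 ∨ j' = j ∧ y (j + 2) = t + 1) ∧ Spans y j' (t + 1) := by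
  by_cases hy : y (j + 2) = t + 1
  · exact ⟨j, .inr ⟨rfl, hy⟩, by omega⟩
  · exact ⟨j + 2, .inl ⟨rfl, hy⟩, by omega⟩

/-- In the strip above, a segment that ends at the level `t + 1` is replaced by its successor, or by
its predecessor, along the part of the chain that joins both segments. -/
theorem GridChain.exists_spans_succ (hC : GridChain n u v x y) (hd : Dirs n u v) {i j : ℕ} {t : ℤ}
    (hij : i + 2 < j) (hjn : j ≤ n) (hi : Spans y i t) (hj : Spans y j t)
    (habove : ∀ k, i < k → k ≤ j → t < y k) (hmin : y (i + 1) = t + 1 ∨ y j = t + 1) :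
    ∃ i' j', i' < j' ∧ j' - i' < j - i ∧ Spans y i' (t + 1) ∧ Spans y j' (t + 1) ∧
      (i' = i ∨ i' = i + 2 ∧ y (i + 1) = t + 1) ∧ (j' = j ∨ j' + 2 = j ∧ y j = t + 1) := by
  obtain ⟨j, rfl⟩ : ∃ k, j = k + 2 := ⟨j - 2, by omega⟩
  have hvi := hi.right_ne_zero hC.stepY (by omega)
  have hvj := hj.right_ne_zero hC.stepY hjn
  have hi1 := (hd.alt i (by omega)).1 ((hd.left_eq_zero_iff (by omega)).2 hvi)
  have hj1 := (hd.swap.alt (j + 1) (by omega)).2 ((hd.left_eq_zero_iff hjn).2 hvj)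
  have hi2 := (hd.swap.alt (i + 1) (by omega)).1 hi1
  have hj2 := (hd.alt j (by omega)).2 hj1
  have hij' : j ≠ i + 1 := by
    rintro rfl
    exact (hd.left_eq_zero_iff (by omega)).1 hj2 hi1
  have hyi : y (i + 2) = y (i + 1) := hC.stepY.eq (by omega) hi1
  have hyj : y (j + 2) = y (j + 1) := hC.stepY.eq (by omega) hj1
  have hupi : y (i + 3) ≠ y (i + 2) :=
    hC.stepY.ne (by omega) ((hd.left_eq_zero_iff (by omega)).1 hi2)
  have hupj : y (j + 1) ≠ y j := hC.stepY.ne (by omega) ((hd.left_eq_zero_iff (by omega)).1 hj2)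
  have h1 := habove (i + 1) (by omega) (by omega)
  have h2 := habove (i + 3) (by omega) (by omega)
  have h3 := habove j (by omega) (by omega)
  have h4 := habove (j + 2) (by omega) le_rfl
  obtain ⟨i', hi', hspan⟩ := hi.exists_next h1 h2 hyi hupi
  obtain ⟨j', hj', hspan'⟩ := hj.exists_prev h4 h3 hyj hupj
  have hne : i' ≠ j' := by
    rintro rfl
    obtain ⟨rfl, h⟩ : i' = i + 2 ∧ i + 2 = j := by omega
    subst h
    simp only [add_assoc, Nat.reduceAdd] at *
    omega
  exact ⟨i', j', by omega, by omega, hspan, hspan', by omega, by omega⟩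

theorem GridChain.lt_of_spans_add_two (hC : GridChain n u v x y) (hd : Dirs n u v)
    (hr : ¬ RightHook n u v) {i : ℕ} {t : ℤ} (hin : i + 2 ≤ n) (hi : Spans y i t)
    (hj : Spans y (i + 2) t) (hup : t < y (i + 1)) : x (i + 2) < x i := by
  have hui := (hd.left_eq_zero_iff (by omega)).2 (hi.right_ne_zero hC.stepY (by omega))
  have hv := (hd.alt i (by omega)).1 hui
  have hu := (hd.swap.left_eq_zero_iff (by omega)).1 hv
  have hxi := hC.stepX.eq (by omega) hui
  have hyi : y (i + 2) = y (i + 1) := hC.stepY.eq (by omega) hv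
  have hstep := hC.stepX (i + 1) (by omega)
  have := hC.stepY i (by omega)
  have := hC.stepY (i + 2) hin
  have hwest : u (i + 1) ≠ 1 := fun h => hr ⟨i, hin, by omega, h⟩
  simp only [add_assoc, Nat.reduceAdd] at *
  omega

theorem GridChain.lt_of_spans_of_above (hC : GridChain n u v x y) (hd : Dirs n u v)
    (hr : ¬ RightHook n u v) {i j : ℕ} {t : ℤ} (hij : i < j) (hjn : j ≤ n) (hi : Spans y i t)
    (hj : Spans y j t) (habove : ∀ k, i < k → k ≤ j → t < y k)
    (hmin : y (i + 1) = t + 1 ∨ y j = t + 1)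
    (ih : ∀ i' j' t', i' < j' → j' ≤ n → j' - i' < j - i → Spans y i' t' → Spans y j' t' →
      x j' < x i') :
    x j < x i := by
  have hvi := hi.right_ne_zero hC.stepY (by omega)
  have hvj := hj.right_ne_zero hC.stepY hjn
  have hui := (hd.left_eq_zero_iff (by omega)).2 hvi
  have huj := (hd.left_eq_zero_iff hjn).2 hvj
  have hi1 := (hd.alt i (by omega)).1 hui
  have hyi := hC.stepY.eq (by omega) hi1
  have hxi := hC.stepX.eq (by omega) hui
  have hupi := habove (i + 1) (by omega) (by omega)
  have hupj := habove j (by omega) le_rfl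
  have hne : j ≠ i + 1 := by
    rintro rfl
    exact hvj hi1
  obtain rfl | hlt : j = i + 2 ∨ i + 2 < j := by omega
  · exact hC.lt_of_spans_add_two hd hr hjn hi hj hupi
  · obtain ⟨i', j', hij', hdist, hspani, hspanj, hi', hj'⟩ :=
      hC.exists_spans_succ hd hlt hjn hi hj habove hmin
    have hlt' := ih i' j' _ hij' (by omega) hdist hspani hspanj
    have hlti : x j' < x i := by
      obtain rfl | ⟨rfl, h⟩ := hi'
      · exact hlt'
      · have := hC.not_between_of_crosses (k := i + 1) (l := j') (by omega) (by omega) (by omega)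
          hyi.symm (by omega)
        simp only [add_assoc, Nat.reduceAdd] at *
        omega
    obtain rfl | ⟨rfl, h⟩ := hj'
    · exact hlti
    · have hj1 := (hd.swap.alt (j' + 1) (by omega)).2 huj
      have hyj := hC.stepY.eq (by omega) hj1
      have := hC.not_between_of_crosses (k := j' + 1) (l := i) (by omega) (by omega) (by omega)
        hyj.symm (by simp only [add_assoc, Nat.reduceAdd] at *; omega)
      have hxj := hC.stepX.eq (i := j') (by omega) ((hd.alt j' (by omega)).2 hj1)
      simp only [add_assoc, Nat.reduceAdd] at *
      omega

theorem GridChain.lt_of_spans_of_not_spans (hC : GridChain n u v x y) (hd : Dirs n u v)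
    (hr : ¬ RightHook n u v) {i j : ℕ} {t : ℤ} (hij : i < j) (hjn : j ≤ n) (hi : Spans y i t)
    (hj : Spans y j t) (hup : t < y (i + 1))
    (hno : ∀ k s, i < k → k < j → Spans y i s → Spans y j s → ¬ Spans y k s)
    (ih : ∀ i' j' t', i' < j' → j' ≤ n → j' - i' < j - i → Spans y i' t' → Spans y j' t' →
      x j' < x i') :
    x j < x i := by
  have hupj := lt_of_not_spans hup (fun k hik hkj => hno k t hik hkj hi hj) j hij le_rfl
  obtain ⟨s, hs, hts, hsi, hsj⟩ :
      ∃ s, (y (i + 1) = s + 1 ∨ y j = s + 1) ∧ t ≤ s ∧ s < y (i + 1) ∧ s < y j :=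
    ⟨min (y (i + 1)) (y j) - 1, by omega⟩
  have hi' : Spans y i s := by omega
  have hj' : Spans y j s := by omega
  exact hC.lt_of_spans_of_above hd hr hij hjn hi' hj'
    (lt_of_not_spans hsi fun k hik hkj => hno k s hik hkj hi' hj') hs ih

/-- If the segments `i` and `j` span a common strip consecutively, the strip is moved along the part
of the chain that joins them: the distance `j - i` decreases until a single hook is left. -/
theorem GridChain.lt_of_spans (hC : GridChain n u v x y) (hd : Dirs n u v)
    (hr : ¬ RightHook n u v) {i j : ℕ} {t : ℤ} (hij : i < j) (hjn : j ≤ n) (hi : Spans y i t)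
    (hj : Spans y j t) : x j < x i := by
  induction hm : j - i using Nat.strong_induction_on generalizing i j t with
  | _ d ih =>
  subst hm
  replace ih : ∀ i' j' t', i' < j' → j' ≤ n → j' - i' < j - i → Spans y i' t' → Spans y j' t' →
      x j' < x i' := fun i' j' t' h h' hlt hi' hj' => ih _ hlt h h' hi' hj' rfl
  by_cases hno : ∀ k s, i < k → k < j → Spans y i s → Spans y j s → ¬ Spans y k s
  · rcases lt_or_ge t (y (i + 1)) with hup | hdown
    · exact hC.lt_of_spans_of_not_spans hd hr hij hjn hi hj hup hno ih
    · refine hC.neg_right.lt_of_spans_of_not_spans hd.swap.neg_left.swap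
        (mt RightHook.of_neg_right hr) hij hjn hi.neg hj.neg ?_ ?_ ?_
      · rw [Pi.neg_apply]
        omega
      · exact fun k s hik hkj his hjs hks => hno k (-s - 1) hik hkj
          (neg_neg y ▸ his.neg) (neg_neg y ▸ hjs.neg) (neg_neg y ▸ hks.neg)
      · exact fun i' j' s h h' hlt his hjs => ih i' j' (-s - 1) h h' hlt
          (neg_neg y ▸ his.neg) (neg_neg y ▸ hjs.neg)
  · push Not at hno
    obtain ⟨k, s, hik, hkj, his, hjs, hks⟩ := hno
    exact (ih k j s hkj hjn (by omega) hks hjs).trans (ih i k s hik (by omega) (by omega) his hks)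

theorem Dirs.exists_first (hd : Dirs n u v) (hn : 1 ≤ n) :
    ∃ i ≤ 1, v i ≠ 0 ∧ ∀ x y, Steps n u x → Steps n v y → x i = x 1 ∧ y i = y 0 := by
  by_cases hv : v 0 = 0
  · have hu : u 1 = 0 := (hd.swap.alt 0 hn).1 hv
    exact ⟨1, le_rfl, (hd.left_eq_zero_iff hn).1 hu, fun x y _ hy => ⟨rfl, hy.eq n.zero_le hv⟩⟩
  · have hu : u 0 = 0 := (hd.left_eq_zero_iff n.zero_le).2 hv
    exact ⟨0, zero_le_one, hv, fun x y hx _ => ⟨(hx.eq n.zero_le hu).symm, rfl⟩⟩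

/-- The first and the last vertical segment of the chain can be made to span a common strip, so that
the chain ends to the west of its beginning. -/
theorem exists_rightHook_of_reach (hd : Dirs n u v) (hn : 1 ≤ n) (ha : 0 < a)
    (h : Reach n u v a 0) : RightHook n u v := by
  by_contra hr
  obtain ⟨x, y, hC, hxa, hyn⟩ := h
  obtain ⟨i, hi1, hvi, hi⟩ := hd.exists_first hn
  obtain ⟨j, hjn, hnj, hvj, hj⟩ := hd.exists_last hn
  obtain ⟨z, hz, hzn, hzk⟩ := hC.exists_level hd hn hyn (if v j = v i then v i else 0)
  have := hC.startX
  have := hC.startY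
  have := hz.startY
  have := hi x y hC.stepX hC.stepY
  have := hj x y hC.stepX hC.stepY
  have := hi x z hz.stepX hz.stepY
  have := hj x z hz.stepX hz.stepY
  have hij : i < j := by
    have := hC.stepY.ne (hi1.trans hn) hvi
    by_contra! hji
    obtain rfl | ⟨rfl, rfl⟩ : i = j ∨ j = 0 ∧ i = 1 := by omega
    · omega
    · exact hvj ((hd.swap.alt 0 hn).2 ((hd.left_eq_zero_iff hn).2 hvi))
  have hlt : x j < x i := by
    have := hC.stepY i (by omega)
    have := hC.stepY j hjn
    have := hzk (i + 1) (by omega)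
    have := hzk j hjn
    refine hz.lt_of_spans hd hr (t := if v i = 1 then 0 else -1) hij hjn ?_ ?_ <;>
      split_ifs at * <;> omega
  obtain rfl | hn' : n = 1 ∨ 0 + 1 < n := by omega
  · omega
  · have := hC.apart 0 n hn' le_rfl
    rw [zero_add] at this
    omega

theorem exists_reach_iff_rightHook (hd : Dirs n u v) (hn : 1 ≤ n) :
    (∃ a > 0, Reach n u v a 0) ↔ RightHook n u v :=
  ⟨fun ⟨_, ha, h⟩ => exists_rightHook_of_reach hd hn ha h, RightHook.exists_reach hd⟩

/-- A vertical segment of the chain contains the points `(c, t)` and `(c, t')`. Exchanging `x` and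
`y` gives the corresponding notion for horizontal segments. -/
def Covers (n : ℕ) (x y : ℕ → ℤ) (c t t' : ℤ) : Prop :=
  ∃ i ≤ n, x i = c ∧ x (i + 1) = c ∧ Between t (y i) (y (i + 1)) ∧ Between t' (y i) (y (i + 1))

/-- A step upwards, or a step along a horizontal segment of the chain. Such steps force the level
of their end to be at least that of their beginning, in every vertical deformation of the chain. -/
inductive UpStep (n : ℕ) (x y : ℕ → ℤ) : ℤ × ℤ → ℤ × ℤ → Prop
  | rise {c t t' : ℤ} (h : t ≤ t') : UpStep n x y (c, t) (c, t')
  | slide {c c' t : ℤ} (h : Covers n y x t c c') : UpStep n x y (c, t) (c', t)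

/-- A sequence of steps in the sense of `UpStep`. -/
abbrev UpPath (n : ℕ) (x y : ℕ → ℤ) : ℤ × ℤ → ℤ × ℤ → Prop :=
  Relation.ReflTransGen (UpStep n x y)

theorem Covers.symm {t t' : ℤ} (h : Covers n x y c t t') : Covers n x y c t' t := by
  obtain ⟨i, hi, hx, hx', ht, ht'⟩ := h
  exact ⟨i, hi, hx, hx', ht', ht⟩

theorem GridChain.covers_or_eq (hC : GridChain n u v x y) (hd : Dirs n u v) {i k : ℕ} (hi : i ≤ n)
    (hk : k = i ∨ k = i + 1) (hc : Between c (x i) (x (i + 1))) :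
    Covers n y x (y k) (x k) c ∨ x k = c := by
  by_cases hv : v i = 0
  · have := hC.stepY.eq hi hv
    refine .inl ⟨i, hi, ?_, ?_, ?_, hc⟩ <;> obtain rfl | rfl := hk <;> omega
  · have := hC.stepX.eq hi ((hd.left_eq_zero_iff hi).2 hv)
    obtain rfl | rfl := hk <;> omega

theorem GridChain.upPath_of_le (hC : GridChain n u v x y) (hd : Dirs n u v) {i j k l : ℕ}
    (hi : i ≤ n) (hj : j ≤ n) (hij : ¬ Separated (x i) (x (i + 1)) (x j) (x (j + 1)))
    (hk : k = i ∨ k = i + 1) (hl : l = j ∨ l = j + 1) (hkl : y k ≤ y l) :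
    UpPath n x y (x k, y k) (x l, y l) := by
  obtain ⟨c, hci, hcj⟩ : ∃ c, Between c (x i) (x (i + 1)) ∧ Between c (x j) (x (j + 1)) :=
    ⟨max (min (x i) (x (i + 1))) (min (x j) (x (j + 1))), by omega, by omega⟩
  have hrise : UpPath n x y (c, y k) (c, y l) := .single (.rise hkl)
  have hleft : UpPath n x y (x k, y k) (c, y k) := by
    obtain h | h := hC.covers_or_eq hd hi hk hci
    · exact .single (.slide h)
    · rw [h]
  have hright : UpPath n x y (c, y l) (x l, y l) := by
    obtain h | h := hC.covers_or_eq hd hj hl hcj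
    · exact .single (.slide h.symm)
    · rw [h]
  exact (hleft.trans hrise).trans hright

/-- All vertices that are not forced upwards by the first one are lowered by the same amount. -/
theorem GridChain.reach_of_not_upPath (hC : GridChain n u v x y) (hd : Dirs n u v)
    (hb : 0 ≤ y (n + 1)) (h : ¬ UpPath n x y (0, 0) (x (n + 1), y (n + 1))) :
    Reach n u v (x (n + 1)) 0 := by
  classical
  let z : ℕ → ℤ := fun k => if UpPath n x y (0, 0) (x k, y k) then y k else y k - y (n + 1)
  refine ⟨x, z, hC.deform ?_ (fun i hi heq => ?_) fun i hi j hj hij k l hk hl hkl => ?_, rfl, ?_⟩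
  · simp only [z, hC.startX, hC.startY, Relation.ReflTransGen.refl, if_true]
  · have hiff : UpPath n x y (0, 0) (x i, y i) ↔ UpPath n x y (0, 0) (x (i + 1), y (i + 1)) :=
      ⟨fun h => h.trans (hC.upPath_of_le hd hi hi (by omega) (.inl rfl) (.inr rfl) heq.ge),
        fun h => h.trans (hC.upPath_of_le hd hi hi (by omega) (.inr rfl) (.inl rfl) heq.le)⟩
    simp only [z, hiff, heq]
  · have himp : UpPath n x y (0, 0) (x k, y k) → UpPath n x y (0, 0) (x l, y l) :=
      fun h => h.trans (hC.upPath_of_le hd hi hj hij hk hl hkl.le)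
    simp only [z]
    split_ifs with hk hl
    · exact hkl
    · exact absurd (himp hk) hl
    · omega
    · omega
  · simp only [z, if_neg h, sub_self]

theorem GridChain.adjacent (hC : GridChain n u v x y) {i j : ℕ} {t : ℤ} (hi : i ≤ n) (hj : j ≤ n)
    (hxi : Between c (x i) (x (i + 1))) (hyi : Between t (y i) (y (i + 1)))
    (hxj : Between c (x j) (x (j + 1))) (hyj : Between t (y j) (y (j + 1))) :
    i ≤ j + 1 ∧ j ≤ i + 1 := by
  by_contra hne
  obtain hlt | hlt : i + 1 < j ∨ j + 1 < i := by omega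
  · have := hC.apart i j hlt hj
    omega
  · have := hC.apart j i hlt hi
    omega

theorem GridChain.not_branch (hC : GridChain n u v x y) {c' t t₁ t₂ : ℤ}
    (ht : t₁ < t ∧ t < t₂ ∨ t₂ < t ∧ t < t₁) (hdown : Covers n x y c t t₁)
    (hup : Covers n x y c t t₂) : ¬ Covers n y x t c c' := by
  obtain ⟨i, hi, hi₁, hi₂, hi₃, hi₄⟩ := hdown
  obtain ⟨j, hj, hj₁, hj₂, hj₃, hj₄⟩ := hup
  rintro ⟨k, hk, hk₁, hk₂, hk₃, hk₄⟩
  have hij := hC.adjacent (c := c) hi hj (by omega) hi₃ (by omega) hj₃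
  have hik := hC.adjacent (c := c) hi hk (by omega) hi₃ hk₃ (by omega)
  have hjk := hC.adjacent (c := c) hj hk (by omega) hj₃ hk₃ (by omega)
  have hik' : i ≠ k := by
    rintro rfl
    omega
  have hjk' : j ≠ k := by
    rintro rfl
    omega
  obtain rfl : i = j := by omega
  obtain rfl | rfl : k = i + 1 ∨ i = k + 1 := by omega
  · omega
  · omega

/-- A path from `f` to `g` meets each row `t` in an interval from `lo t` to `hi t`, and the chain
runs along this interval. -/
structure Profile (n : ℕ) (x y : ℕ → ℤ) (f g : ℤ × ℤ) (lo hi : ℤ → ℤ) : Prop where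
  start : lo f.2 ≤ f.1 ∧ f.1 ≤ hi f.2
  finish : lo g.2 ≤ g.1 ∧ g.1 ≤ hi g.2
  level_le : f.2 ≤ g.2
  above : ∀ t, g.2 < t → lo t = g.1 ∧ hi t = g.1
  overlap : ∀ s t, s ≤ t + 1 → t ≤ s + 1 → lo s ≤ hi t
  edge : ∀ t c, lo t ≤ c → c < hi t → Covers n y x t c (c + 1)

theorem Profile.slide {f : ℤ × ℤ} {c' t : ℤ} {lo hi : ℤ → ℤ} (h : Profile n x y f (c, t) lo hi)
    (hc : Covers n y x t c c') :
    Profile n x y f (c', t)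
      (fun s => if s < t then lo s else if s = t then min (lo s) c' else c')
      (fun s => if s < t then hi s else if s = t then max (hi s) c' else c') := by
  obtain ⟨hs, hf, hle, habove, hov, hedge⟩ := h
  dsimp only at hf hle habove
  refine ⟨?_, ?_, hle, fun s hst => ?_, fun r s hrs hsr => ?_, fun s d => ?_⟩
  · split_ifs <;> omega
  · split_ifs <;> omega
  · have : ¬ s < t ∧ s ≠ t := by
      change t < s at hst
      omega
    simp only [this, if_false, and_self]
  · have := hov r s hrs hsr
    split_ifs <;> omega
  · have := hedge s d
    split_ifs with h h'
    · exact this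
    · subst h'
      intro h₁ h₂
      by_cases hd : lo s ≤ d ∧ d < hi s
      · exact this hd.1 hd.2
      · obtain ⟨i, hi, hy, hy', hx, hx'⟩ := hc
        exact ⟨i, hi, hy, hy', by omega, by omega⟩
    · omega

theorem exists_profile {f g : ℤ × ℤ} (h : UpPath n x y f g) : ∃ lo hi, Profile n x y f g lo hi := by
  induction h with
  | refl => exact ⟨fun _ => f.1, fun _ => f.1, by simp, by simp, le_rfl, by simp, by simp,
      fun t c h₁ h₂ => by omega⟩
  | tail _ hs ih =>
    obtain ⟨lo, hi, h⟩ := ih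
    cases hs with
    | rise hle =>
      obtain ⟨hs, hf, hle', habove, hov, hedge⟩ := h
      refine ⟨lo, hi, hs, ?_, hle'.trans hle, fun s hst => habove s (hle.trans_lt hst), hov, hedge⟩
      obtain rfl | hlt := hle.eq_or_lt
      · exact hf
      · exact ⟨(habove _ hlt).1.le, (habove _ hlt).2.ge⟩
    | slide hc => exact ⟨_, _, h.slide hc⟩

theorem Profile.covers {f g : ℤ × ℤ} {d t : ℤ} {lo hi : ℤ → ℤ} (h : Profile n x y f g lo hi)
    (hc : lo t ≤ c ∧ c ≤ hi t) (hd : lo t ≤ d ∧ d ≤ hi t) (hcd : d = c + 1 ∨ c = d + 1) :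
    Covers n y x t c d := by
  obtain rfl | rfl := hcd
  · exact h.edge t c hc.1 (by omega)
  · exact (h.edge t d hd.1 (by omega)).symm

theorem induction_on_interval {P : ℤ → Prop} (l r : ℤ) (hb : l ≤ b ∧ b ≤ r) (hc : l ≤ c ∧ c ≤ r)
    (hstep : ∀ d e, l ≤ d ∧ d ≤ r → l ≤ e ∧ e ≤ r → (e = d + 1 ∨ d = e + 1) → P d → P e)
    (h : P b) : P c := by
  rcases le_total b c with hbc | hcb
  · induction c, hbc using Int.leInduction with
    | base => exact h
    | succ d hd ih => exact hstep d (d + 1) (by omega) (by omega) (.inl rfl) (ih (by omega))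
  · induction c, hcb using Int.leInductionDown with
    | base => exact h
    | pred d hd ih => exact hstep d (d - 1) (by omega) (by omega) (by omega) (ih (by omega))

/-- In the row `t`, the path with the profile `lo', hi'` cannot get from above the path with the
column profile `lo, hi` to below it: this would require a branching point of the chain. -/
theorem GridChain.corner_of_profiles (hC : GridChain n u v x y) {f g f' g' : ℤ × ℤ}
    {lo hi lo' hi' : ℤ → ℤ} {c' t : ℤ} (hP : Profile n y x f g lo hi)
    (hP' : Profile n x y f' g' lo' hi') (hc : lo' t ≤ c ∧ c ≤ hi' t)
    (hc' : lo' t ≤ c' ∧ c' ≤ hi' t) (hlt : hi c < t) :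
    hi c' < t ∨ hi c' = t ∧ Covers n x y c' t (t - 1) ∧
      ∃ d, (d = c' + 1 ∨ c' = d + 1) ∧ hi d < t ∧ Covers n y x t c' d := by
  refine induction_on_interval (P := fun c' => hi c' < t ∨ hi c' = t ∧ Covers n x y c' t (t - 1) ∧
    ∃ d, (d = c' + 1 ∨ c' = d + 1) ∧ hi d < t ∧ Covers n y x t c' d) _ _ hc hc'
    (fun d e hd he hde ih => ?_) (.inl hlt)
  have hcov := hP'.covers hd he hde
  obtain hdt | ⟨-, hdown, d', hd', hlt', hcov'⟩ := ih
  · obtain het | het : hi e < t ∨ t ≤ hi e := lt_or_ge _ _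
    · exact .inl het
    have hlo := hP.overlap e d (by omega) (by omega)
    have hdown : Covers n x y e t (t - 1) := hP.covers (by omega) (by omega) (by omega)
    have hup : ¬ t < hi e := fun h => hC.not_branch (by omega) hdown
      (hP.covers (d := t + 1) (by omega) (by omega) (.inl rfl)) hcov.symm
    exact .inr ⟨by omega, hdown, d, by omega, hdt, hcov.symm⟩
  · obtain rfl | hne := eq_or_ne e d'
    · exact .inl hlt'
    · have hbetween : d' < d ∧ d < e ∨ e < d ∧ d < d' := by omega
      exact absurd hdown (hC.swap.not_branch hbetween hcov' hcov)

theorem GridChain.eq_of_end (hC : GridChain n u v x y) (hd : Dirs n u v) {i : ℕ} (hi : i ≤ n)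
    (hx : Between (x (n + 1)) (x i) (x (i + 1))) (hy : Between (y (n + 1)) (y i) (y (i + 1))) :
    i = n := by
  by_contra hne
  have := (hC.adjacent hi le_rfl hx hy (by omega) (by omega)).2
  obtain rfl : n = i + 1 := by omega
  by_cases hv : v i = 0
  · have := hC.stepY.eq hi hv
    have := hC.stepY.ne le_rfl
      ((hd.left_eq_zero_iff le_rfl).1 ((hd.swap.alt i i.lt_succ_self).1 hv))
    omega
  · have hu := (hd.left_eq_zero_iff hi).2 hv
    have := hC.stepX.eq hi hu
    have := hC.stepX.ne le_rfl
      ((hd.swap.left_eq_zero_iff le_rfl).1 ((hd.alt i i.lt_succ_self).1 hu))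
    omega

theorem GridChain.eq_zero_of_start (hC : GridChain n u v x y) (hd : Dirs n u v) {i : ℕ} (hi : i ≤ n)
    (hx : Between 0 (x i) (x (i + 1))) (hy : Between 0 (y i) (y (i + 1))) : i = 0 := by
  have hin : n + 1 - (n - i) = i + 1 ∧ n + 1 - (n - i + 1) = i := by omega
  have := hC.rev.eq_of_end hd.rev (n.sub_le i)
  simp only [hin, Nat.sub_self, hC.startX, hC.startY] at this
  omega

theorem GridChain.column_zero (hC : GridChain n u v x y) (hd : Dirs n u v) (hv : v 0 = -1)
    {g : ℤ × ℤ} {lo hi : ℤ → ℤ} (hP : Profile n y x (0, 0) g lo hi) : hi 0 ≤ 0 := by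
  by_contra! hpos
  obtain ⟨i, hi, hx, hx', hy, hy'⟩ := hP.edge 0 0 hP.start.1 hpos
  obtain rfl := hC.eq_zero_of_start hd hi (by omega) hy
  have := hC.stepY 0 hi
  have := hC.startY
  omega

theorem GridChain.row_zero (hC : GridChain n u v x y) (hd : Dirs n u v) (hv : v 0 ≠ 0)
    {g : ℤ × ℤ} {lo hi : ℤ → ℤ} (hP : Profile n x y (0, 0) g lo hi) : lo 0 = 0 ∧ hi 0 = 0 := by
  have hno : ∀ c c', Covers n y x 0 c c' → ¬ Between 0 c c' := by
    rintro c c' ⟨i, hi, hy, hy', hx, hx'⟩ hc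
    obtain rfl := hC.eq_zero_of_start hd hi (by omega) (by omega)
    exact hC.stepY.ne hi hv (hy'.trans hy.symm)
  have hstart : lo 0 ≤ 0 ∧ 0 ≤ hi 0 := hP.start
  by_contra hne
  obtain hlt | hlt : lo 0 < 0 ∨ 0 < hi 0 := by omega
  · exact hno _ _ (hP.edge 0 (-1) (by omega) (by omega)) (by omega)
  · exact hno _ _ (hP.edge 0 0 hstart.1 hlt) (by omega)

/-- Above a first segment that goes down, the path upwards stays above the path to the right. -/
theorem GridChain.exists_lt_of_profiles (hC : GridChain n u v x y) (hd : Dirs n u v)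
    (hv : v 0 = -1) {g g' : ℤ × ℤ} {lo hi lo' hi' : ℤ → ℤ} (hP : Profile n y x (0, 0) g lo hi)
    (hP' : Profile n x y (0, 0) g' lo' hi') {t : ℤ} (ht : 1 ≤ t) :
    ∃ c, (lo' t ≤ c ∧ c ≤ hi' t) ∧ hi c < t := by
  induction t, ht using Int.leInduction with
  | base =>
    have hcol := hC.column_zero hd hv hP
    have hrow := hC.row_zero hd (by omega) hP'
    have := hP'.overlap 0 1 (by omega) (by omega)
    have := hP'.overlap 1 0 (by omega) (by omega)
    exact ⟨0, by omega, by omega⟩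
  | succ t _ ih =>
    obtain ⟨c, hc, hlt⟩ := ih
    have := hP'.overlap t (t + 1) (by omega) (by omega)
    have := hP'.overlap (t + 1) t (by omega) (by omega)
    have := hP'.overlap (t + 1) (t + 1) (by omega) (by omega)
    have := hC.corner_of_profiles hP hP' hc (c' := max (lo' t) (lo' (t + 1))) (by omega) hlt
    exact ⟨max (lo' t) (lo' (t + 1)), by omega, by omega⟩

theorem GridChain.not_upPath_of_rightPath (hC : GridChain n u v x y) (hd : Dirs n u v)
    (hv : v 0 = -1) (hb : 0 < y (n + 1)) (hright : UpPath n y x (0, 0) (y (n + 1), x (n + 1))) :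
    ¬ UpPath n x y (0, 0) (x (n + 1), y (n + 1)) := by
  intro hup
  obtain ⟨lo, hi, hP⟩ := exists_profile hright
  obtain ⟨lo', hi', hP'⟩ := exists_profile hup
  obtain ⟨c, hc, hlt⟩ := hC.exists_lt_of_profiles hd hv hP hP' (t := y (n + 1)) hb
  obtain hlt | ⟨-, ⟨i, hi, hx, hx', hy, hy'⟩, d, hd', -, j, hj, hjy, hjy', hjx, -⟩ :=
    hC.corner_of_profiles hP hP' hc hP'.finish hlt
  · exact hP.finish.2.not_gt hlt
  · obtain rfl := hC.eq_of_end hd hi (by omega) hy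
    obtain rfl := hC.eq_of_end hd hj hjx (by omega)
    omega

/-- Two directions at distance two are opposite: the sequence of directions has a hook. -/
def Hooked (n : ℕ) (u v : ℕ → ℤ) : Prop :=
  ∃ i, i + 2 ≤ n ∧ u i = -u (i + 2) ∧ v i = -v (i + 2)

theorem Hooked.swap (h : Hooked n u v) : Hooked n v u := by
  obtain ⟨i, hi, hu, hv⟩ := h
  exact ⟨i, hi, hv, hu⟩

theorem Hooked.neg_left (h : Hooked n u v) : Hooked n (-u) v := by
  obtain ⟨i, hi, hu, hv⟩ := h
  exact ⟨i, hi, congrArg Neg.neg hu, hv⟩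

theorem Hooked.rev (h : Hooked n u v) : Hooked n (revDirs n u) (revDirs n v) := by
  obtain ⟨i, hi, hu, hv⟩ := h
  have hk : n - (n - (i + 2)) = i + 2 ∧ n - (n - (i + 2) + 2) = i := by omega
  refine ⟨n - (i + 2), by omega, ?_, ?_⟩
  · rw [revDirs, revDirs, hk.1, hk.2, hu, neg_neg]
  · rw [revDirs, revDirs, hk.1, hk.2, hv, neg_neg]

theorem Dirs.eq_add_two_mul_of_not_hooked (hd : Dirs n u v) (h : ¬Hooked n u v) {i k : ℕ}
    (hi : i + 2 * k ≤ n) : v i = v (i + 2 * k) := by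
  induction k with
  | zero => rfl
  | succ k ih =>
    rw [ih (by omega), mul_add_one, ← add_assoc]
    obtain ⟨j, hj⟩ : ∃ j, j = i + 2 * k := ⟨_, rfl⟩
    rw [← hj]
    have hj2 : j + 2 ≤ n := by omega
    have a0 := hd.alt j (by omega)
    have a1 : u (j + 1) = 0 ↔ v (j + 2) = 0 := hd.alt (j + 1) (by omega)
    have d0 := hd.dir j (by omega)
    have d1 := hd.dir (j + 1) (by omega)
    have d2 := hd.dir (j + 2) hj2
    have hne : ¬(u j = -u (j + 2) ∧ v j = -v (j + 2)) := fun hj' => h ⟨j, hj2, hj'⟩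
    omega

theorem GridChain.nonpos_of_not_hooked (hC : GridChain n u v x y) (hd : Dirs n u v)
    (h : ¬Hooked n u v) (hv : v n = 0) (hv' : v (n - 1) = -1) : ∀ k ≤ n + 1, y k ≤ 0 := by
  have hle : ∀ i ≤ n, v i ≠ 1 := fun i hi => by
    obtain ⟨k, rfl | rfl⟩ : ∃ k, n = i + 2 * k ∨ n = i + 2 * k + 1 := ⟨(n - i) / 2, by omega⟩
    · rw [hd.eq_add_two_mul_of_not_hooked h le_rfl, hv]
      decide
    · rw [hd.eq_add_two_mul_of_not_hooked h (Nat.le_succ _), ← Nat.add_sub_cancel (_ + _) 1, hv']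
      decide
  intro k hk
  induction k with
  | zero => exact hC.startY.le
  | succ k ih =>
    have := hC.stepY k (by omega)
    have := hle k (by omega)
    omega

/-- Without its last segment, the chain ends below the axis, on it, or above it. It suffices to
shorten the last segment, to append it to a chain that ends on the axis, or to use induction. -/
theorem Reach.axis_of_last_up (hd : Dirs (n + 1) u v)
    (ih : ∀ {c}, Hooked n u v → Reach n u v a c → c ≠ 0 → Reach n u v a 0 ∨ Reach n u v 0 c)
    (hk : Hooked (n + 1) u v) (hv : v (n + 1) = 1) (h : Reach (n + 1) u v a b) (hb : 0 < b) :
    Reach (n + 1) u v a 0 ∨ Reach (n + 1) u v 0 b := by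
  obtain ⟨i, hi, hui, hvi⟩ := hk
  have hn : 1 ≤ n := by omega
  obtain ⟨x, y, hC, rfl, rfl⟩ := h
  have hu : u (n + 1) = 0 := (hd.left_eq_zero_iff le_rfl).2 (by omega)
  have hC' := hC.mono n.le_succ
  have hx : x (n + 2) = x (n + 1) := hC.stepX.eq le_rfl hu
  have hr : Reach n u v (x (n + 2)) (y (n + 1)) := ⟨x, y, hC', hx.symm, rfl⟩
  have hlt : y (n + 1) < y (n + 2) := by
    have : _ ∨ (_ ∧ y (n + 1) < y (n + 2)) ∨ _ := hC.stepY (n + 1) le_rfl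
    omega
  obtain hneg | hzero | hpos := lt_trichotomy (y (n + 1)) 0
  · exact .inl (hC.truncate hu hv hneg hb.le)
  · exact .inl ((hzero ▸ hr).append_axis hn hd hu)
  · by_cases hk' : Hooked n u v
    · exact (ih hk' hr hpos.ne').imp (·.append_axis hn hd hu) (·.append_up hpos.le hd hv hlt)
    · have hin : i + 1 = n := by
        by_contra hne
        exact hk' ⟨i, by omega, hui, hvi⟩
      subst hin
      have hvn : v (i + 1) = 0 := (hd.swap.alt (i + 1) (by omega)).2 hu
      have hvi' : v i = -1 := by rw [hvi, hv]
      exact absurd (hC'.nonpos_of_not_hooked (hd.mono (Nat.le_succ _)) hk' hvn hvi' _ le_rfl)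
        hpos.not_ge

theorem Reach.axis_of_first_down (hd : Dirs n u v) (hv : v 0 = -1) (h : Reach n u v a b)
    (ha : 0 < a) (hb : 0 < b) : Reach n u v a 0 ∨ Reach n u v 0 b := by
  obtain ⟨x, y, hC, rfl, rfl⟩ := h
  by_cases hright : UpPath n y x (0, 0) (y (n + 1), x (n + 1))
  · exact .inl (hC.reach_of_not_upPath hd hb.le (hC.not_upPath_of_rightPath hd hv hb hright))
  · exact .inr (reach_swap_iff.1 (hC.swap.reach_of_not_upPath hd.swap ha.le hright))

theorem Reach.axis (hd : Dirs n u v) (hk : Hooked n u v) (h : Reach n u v a b) (ha : a ≠ 0)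
    (hb : b ≠ 0) : Reach n u v a 0 ∨ Reach n u v 0 b := by
  induction n generalizing u v a b with
  | zero =>
    obtain ⟨i, hi, -⟩ := hk
    omega
  | succ n ih =>
    wlog hapos : 0 < a generalizing u a
    · exact (this hd.neg_left hk.neg_left h.neg_left (neg_ne_zero.2 ha) (by omega)).imp
        reach_neg_left_iff.1 fun h => reach_neg_left_iff.1 (by rwa [neg_zero])
    wlog hbpos : 0 < b generalizing v b
    · exact (this (neg_ne_zero.2 hb) hd.swap.neg_left.swap hk.swap.neg_left.swap
        (reach_neg_right_iff.2 h) (by omega)).imp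
        (fun h => reach_neg_right_iff.1 (by rwa [neg_zero])) reach_neg_right_iff.1
    wlog hu : u 0 = 0 generalizing u v a b
    · exact (this hb hbpos ha hd.swap hk.swap (reach_swap_iff.2 h) hapos
        (not_not.1 fun hv => hu ((hd.left_eq_zero_iff n.succ.zero_le).2 hv))).symm.imp
        reach_swap_iff.1 reach_swap_iff.1
    obtain hv | hv : v 0 = 1 ∨ v 0 = -1 := by
      have := hd.dir 0 (by omega)
      omega
    · have := h.rev.axis_of_last_up hd.rev (fun hk h hc => ih (hd.rev.mono n.le_succ) hk h ha hc)
        hk.rev (by simpa only [revDirs, Nat.sub_self]) hbpos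
      exact this.imp reach_rev_iff.1 reach_rev_iff.1
    · exact h.axis_of_first_down hd hv hapos hbpos

theorem Dirs.eq_mod_two_of_not_hooked (hd : Dirs n u v) (hn : 1 ≤ n) (hk : ¬Hooked n u v)
    (hu : u 0 = 1) (hv : v 1 = 1) {i : ℕ} (hi : i ≤ n) :
    u i = ((i + 1) % 2 : ℕ) ∧ v i = (i % 2 : ℕ) := by
  have hv0 : v 0 = 0 := not_not.1 (mt (hd.left_eq_zero_iff n.zero_le).2 (by simp [hu]))
  have hu1 : u 1 = 0 := (hd.left_eq_zero_iff hn).2 (by simp [hv])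
  obtain ⟨k, rfl | rfl⟩ : ∃ k, i = 0 + 2 * k ∨ i = 1 + 2 * k := ⟨i / 2, by omega⟩
  · rw [← hd.eq_add_two_mul_of_not_hooked hk hi,
      ← hd.swap.eq_add_two_mul_of_not_hooked (mt Hooked.swap hk) hi]
    omega
  · rw [← hd.eq_add_two_mul_of_not_hooked hk hi,
      ← hd.swap.eq_add_two_mul_of_not_hooked (mt Hooked.swap hk) hi]
    omega

theorem GridChain.half_le (hC : GridChain n u v x y)
    (huv : ∀ i ≤ n, u i = ((i + 1) % 2 : ℕ) ∧ v i = (i % 2 : ℕ)) {k : ℕ} (hk : k ≤ n + 1) :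
    (((k + 1) / 2 : ℕ) : ℤ) ≤ x k ∧ ((k / 2 : ℕ) : ℤ) ≤ y k := by
  induction k with
  | zero => simp [hC.startX, hC.startY]
  | succ k ih =>
    have := hC.stepX k (by omega)
    have := hC.stepY k (by omega)
    have := huv k (by omega)
    omega

theorem gridChain_half (huv : ∀ i ≤ n, u i = ((i + 1) % 2 : ℕ) ∧ v i = (i % 2 : ℕ)) :
    GridChain n u v (fun k => ((k + 1) / 2 : ℕ)) (fun k => (k / 2 : ℕ)) where
  startX := rfl
  startY := rfl
  stepX i hi := by
    have := huv i hi
    dsimp only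
    omega
  stepY i hi := by
    have := huv i hi
    dsimp only
    omega
  apart i j hij _ := by
    dsimp only
    omega

theorem reach_iff_of_not_hooked (hd : Dirs n u v) (hn : 1 ≤ n) (hk : ¬Hooked n u v)
    (hu : u 0 = 1) (hv : v 1 = 1) :
    Reach n u v a b ↔ 1 + ((n / 2 : ℕ) : ℤ) ≤ a ∧ (((n + 1) / 2 : ℕ) : ℤ) ≤ b := by
  have huv : ∀ i ≤ n, _ := fun i => hd.eq_mod_two_of_not_hooked hn hk hu hv
  constructor
  · rintro ⟨x, y, hC, rfl, rfl⟩
    have := hC.half_le huv le_rfl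
    omega
  · rintro ⟨ha, hb⟩
    have hmin : Reach n u v ((n + 2) / 2 : ℕ) ((n + 1) / 2 : ℕ) :=
      ⟨_, _, gridChain_half huv, rfl, rfl⟩
    have hcol := reach_swap_iff.2 (hmin.stretch (by omega) hb)
    exact reach_swap_iff.1 (hcol.stretch (by omega) (by omega))

theorem floor_half (n : ℕ) : ⌊(n : ℚ) / 2⌋ = (n / 2 : ℕ) := by
  exact_mod_cast Rat.floor_natCast_div_natCast n 2

theorem ceil_half (n : ℕ) : ⌈(n : ℚ) / 2⌉ = ((n + 1) / 2 : ℕ) := by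
  have := Rat.ceil_natCast_div_natCast n 2
  push_cast at this
  omega

section Turns

variable {σ : List Turn} {C : ℕ → ℤ × ℤ}

/-- The horizontal component of the heading after `i` turns. -/
def headX (σ : List Turn) (i : ℕ) : ℤ := (heading (σ.take i)).1

/-- The vertical component of the heading after `i` turns. -/
def headY (σ : List Turn) (i : ℕ) : ℤ := (heading (σ.take i)).2

theorem heading_take_succ {i : ℕ} (hi : i < σ.length) :
    heading (σ.take (i + 1)) = Turn.apply (heading (σ.take i)) σ[i] := by
  rw [← List.take_concat_get' σ i hi, heading, List.foldl_append]
  rfl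

theorem headX_zero (σ : List Turn) : headX σ 0 = 1 := rfl

theorem headY_zero (σ : List Turn) : headY σ 0 = 0 := rfl

theorem head_succ {i : ℕ} (hi : i < σ.length) :
    (headX σ (i + 1) = -headY σ i ∧ headY σ (i + 1) = headX σ i) ∨
      (headX σ (i + 1) = headY σ i ∧ headY σ (i + 1) = -headX σ i) := by
  simp only [headX, headY, heading_take_succ hi]
  cases σ[i]
  · exact .inl ⟨rfl, rfl⟩
  · exact .inr ⟨rfl, rfl⟩

theorem dirs_head (σ : List Turn) : Dirs σ.length (headX σ) (headY σ) := by
  have hdir : ∀ i ≤ σ.length, (headX σ i = 0 ∧ (headY σ i = 1 ∨ headY σ i = -1)) ∨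
      (headY σ i = 0 ∧ (headX σ i = 1 ∨ headX σ i = -1)) := fun i hi => by
    induction i with
    | zero => exact .inr ⟨rfl, .inl rfl⟩
    | succ i ih =>
      have := head_succ (σ := σ) (i := i) (by omega)
      omega
  refine ⟨hdir, fun i hi => ?_⟩
  have := head_succ hi
  omega

theorem Turn.apply_apply_eq_neg_iff {d : ℤ × ℤ} (hd : d ≠ 0) {s t : Turn} :
    Turn.apply (Turn.apply d s) t = -d ↔ s = t := by
  have h : d ≠ -d := fun h => hd (self_eq_neg.1 h)
  cases s <;> cases t <;> simp [Turn.apply, Prod.ext_iff] at h ⊢ <;> tauto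

theorem getElem_eq_getElem_succ_iff {i : ℕ} (hi : i + 1 < σ.length) :
    σ[i] = σ[i + 1] ↔ headX σ i = -headX σ (i + 2) ∧ headY σ i = -headY σ (i + 2) := by
  have hne : heading (σ.take i) ≠ 0 := fun h => by
    have := (dirs_head σ).dir i (by omega)
    simp [headX, headY, h] at this
  rw [← Turn.apply_apply_eq_neg_iff hne, ← heading_take_succ, ← heading_take_succ hi,
    eq_neg_iff_add_eq_zero, add_comm, ← eq_neg_iff_add_eq_zero, Prod.ext_iff]
  rfl

theorem hasHook_iff {d : ℤ × ℤ} :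
    HasHook σ d ↔ ∃ i, i + 2 ≤ σ.length ∧ (headX σ i = -headX σ (i + 2) ∧
      headY σ i = -headY σ (i + 2)) ∧ headX σ (i + 1) = d.1 ∧ headY σ (i + 1) = d.2 := by
  constructor
  · rintro ⟨τ, ρ, t, rfl, rfl⟩
    have hlen : τ.length + 1 < (τ ++ t :: t :: ρ).length := by simp
    have htake : (τ ++ t :: t :: ρ).take (τ.length + 1) = τ ++ [t] := by simp [List.take_append]
    exact ⟨τ.length, hlen, (getElem_eq_getElem_succ_iff hlen).1 (by simp), by rw [headX, htake],
      by rw [headY, htake]⟩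
  · rintro ⟨i, hi, hopp, hd⟩
    refine ⟨σ.take i, σ.drop (i + 2), σ[i], ?_, ?_⟩
    · nth_rewrite 2 [(getElem_eq_getElem_succ_iff hi).2 hopp]
      rw [← List.drop_eq_getElem_cons, ← List.drop_eq_getElem_cons, List.take_append_drop]
    · rw [List.take_concat_get']
      exact Prod.ext hd.1 hd.2

theorem isStaircase_iff : IsStaircase σ ↔ ¬Hooked σ.length (headX σ) (headY σ) := by
  rw [IsStaircase, List.isChain_iff_getElem]
  exact ⟨fun h ⟨i, hi, hopp⟩ => h i hi ((getElem_eq_getElem_succ_iff hi).2 hopp),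
    fun h i hi heq => h ⟨i, hi, (getElem_eq_getElem_succ_iff hi).1 heq⟩⟩

theorem disjoint_uIcc_iff {p q r s : ℤ} :
    Disjoint (Set.uIcc (p : ℝ) q) (Set.uIcc (r : ℝ) s) ↔ Separated p q r s := by
  rw [Set.disjoint_iff_inter_eq_empty, Set.uIcc, Set.uIcc, Set.Icc_inter_Icc, Set.Icc_eq_empty_iff]
  norm_cast
  omega

theorem seg_eq_prod {i : ℕ} (h : (C (i + 1)).1 = (C i).1 ∨ (C (i + 1)).2 = (C i).2) :
    seg C i = Set.uIcc ((C i).1 : ℝ) (C (i + 1)).1 ×ˢ Set.uIcc ((C i).2 : ℝ) (C (i + 1)).2 := by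
  obtain h | h := h
  · rw [seg, toPlane, toPlane, h, ← Prod.image_mk_segment_right, segment_eq_uIcc, Set.uIcc_self,
      Set.singleton_prod]
  · rw [seg, toPlane, toPlane, h, ← Prod.image_mk_segment_left, segment_eq_uIcc, Set.uIcc_self,
      Set.prod_singleton]

theorem disjoint_seg_iff {i j : ℕ} (hi : (C (i + 1)).1 = (C i).1 ∨ (C (i + 1)).2 = (C i).2)
    (hj : (C (j + 1)).1 = (C j).1 ∨ (C (j + 1)).2 = (C j).2) :
    Disjoint (seg C i) (seg C j) ↔
      Separated (C i).1 (C (i + 1)).1 (C j).1 (C (j + 1)).1 ∨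
        Separated (C i).2 (C (i + 1)).2 (C j).2 (C (j + 1)).2 := by
  rw [seg_eq_prod hi, seg_eq_prod hj, Set.disjoint_prod, disjoint_uIcc_iff, disjoint_uIcc_iff]

theorem eq_of_mem_seg_of_mem_seg_succ {i : ℕ} {p : ℝ × ℝ}
    (h : ((C (i + 1)).1 = (C i).1 ∧ (C (i + 2)).2 = (C (i + 1)).2) ∨
      ((C (i + 1)).2 = (C i).2 ∧ (C (i + 2)).1 = (C (i + 1)).1))
    (hp : p ∈ seg C i) (hp' : p ∈ seg C (i + 1)) : p = toPlane (C (i + 1)) := by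
  obtain ⟨h1, h2⟩ | ⟨h1, h2⟩ := h
  · rw [seg_eq_prod (.inl h1), h1, Set.uIcc_self] at hp
    rw [seg_eq_prod (.inr h2), h2, Set.uIcc_self] at hp'
    exact Prod.ext (hp.1.trans (by rw [toPlane, h1])) hp'.2
  · rw [seg_eq_prod (.inr h1), h1, Set.uIcc_self] at hp
    rw [seg_eq_prod (.inl h2), h2, Set.uIcc_self] at hp'
    exact Prod.ext hp'.1 (hp.2.trans (by rw [toPlane, h1]))

theorem exists_eq_add_smul_iff {d p q : ℤ × ℤ}
    (hd : (d.1 = 0 ∧ (d.2 = 1 ∨ d.2 = -1)) ∨ (d.2 = 0 ∧ (d.1 = 1 ∨ d.1 = -1))) :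
    (∃ l : ℕ, 0 < l ∧ q = p + (l : ℤ) • d) ↔
      ((d.1 = 0 ∧ q.1 = p.1) ∨ (d.1 = 1 ∧ p.1 < q.1) ∨ (d.1 = -1 ∧ q.1 < p.1)) ∧
        ((d.2 = 0 ∧ q.2 = p.2) ∨ (d.2 = 1 ∧ p.2 < q.2) ∨ (d.2 = -1 ∧ q.2 < p.2)) := by
  simp only [Prod.ext_iff, Prod.fst_add, Prod.snd_add, Prod.smul_fst, Prod.smul_snd, smul_eq_mul]
  constructor
  · rintro ⟨l, hl, h1, h2⟩
    rcases hd with ⟨e1, e2 | e2⟩ | ⟨e1, e2 | e2⟩ <;> simp only [e1, e2] at h1 h2 <;> omega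
  · intro h
    refine ⟨(q.1 - p.1).natAbs + (q.2 - p.2).natAbs, by omega, ?_⟩
    rcases hd with ⟨e1, e2 | e2⟩ | ⟨e1, e2 | e2⟩ <;> rw [e1, e2] <;> constructor <;> omega

theorem Steps.eq_or_eq (hx : Steps n u x) (hd : Dirs n u v) (hy : Steps n v y) {i : ℕ}
    (hi : i ≤ n) : x (i + 1) = x i ∨ y (i + 1) = y i :=
  (hd.dir i hi).imp (fun h => hx.eq hi h.1) fun h => hy.eq hi h.1

theorem realizes_iff : Realizes σ C ↔
    GridChain σ.length (headX σ) (headY σ) (fun k => (C k).1) (fun k => (C k).2) := by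
  have hd := dirs_head σ
  have hstep {i : ℕ} (hi : i ≤ σ.length) := exists_eq_add_smul_iff (p := C i) (q := C (i + 1))
    (d := heading (σ.take i)) (hd.dir i hi)
  constructor
  · intro h
    have hX : Steps σ.length (headX σ) (fun k => (C k).1) := fun i hi =>
      ((hstep hi).1 (h.step i hi)).1
    have hY : Steps σ.length (headY σ) (fun k => (C k).2) := fun i hi =>
      ((hstep hi).1 (h.step i hi)).2
    have haxis {i : ℕ} (hi : i ≤ σ.length) := hX.eq_or_eq hd hY hi
    refine ⟨congrArg Prod.fst h.start, congrArg Prod.snd h.start, hX, hY, fun i j hij hj => ?_⟩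
    refine (disjoint_seg_iff (haxis (by omega)) (haxis hj)).1
      (Set.disjoint_left.2 fun p hpi hpj => ?_)
    have := (h.simple i j (by omega) hj p ⟨hpi, hpj⟩).1
    omega
  · intro h
    have haxis {i : ℕ} (hi : i ≤ σ.length) := h.stepX.eq_or_eq hd h.stepY hi
    refine ⟨Prod.ext h.startX h.startY, fun i hi => (hstep hi).2 ⟨h.stepX i hi, h.stepY i hi⟩,
      fun i j hij hj p hp => ?_⟩
    obtain rfl | hlt : j = i + 1 ∨ i + 1 < j := by omega
    · have hi : i ≤ σ.length := by omega
      refine ⟨rfl, eq_of_mem_seg_of_mem_seg_succ ?_ hp.1 hp.2⟩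
      exact (hd.dir i hi).imp
        (fun hu => ⟨h.stepX.eq hi hu.1, h.stepY.eq hj ((hd.alt i hj).1 hu.1)⟩)
        fun hv => ⟨h.stepY.eq hi hv.1, h.stepX.eq hj ((hd.swap.alt i hj).1 hv.1)⟩
    · exact absurd hp.2 (Set.disjoint_left.1
        ((disjoint_seg_iff (haxis (by omega)) (haxis hj)).2 (h.apart i j hlt hj)) hp.1)

theorem mem_reachable_iff : (a, b) ∈ reachable σ ↔ Reach σ.length (headX σ) (headY σ) a b := by
  constructor
  · rintro ⟨C, hC, hab⟩
    exact ⟨_, _, realizes_iff.1 hC, congrArg Prod.fst hab, congrArg Prod.snd hab⟩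
  · rintro ⟨x, y, hC, ha, hb⟩
    exact ⟨fun k => (x k, y k), realizes_iff.2 hC, Prod.ext ha hb⟩

end Turns

section Reachable

variable {σ : List Turn} {p q : ℤ × ℤ} {P : ℤ → Prop}

/-- The integer `c` lies on the same side of `0` as `a`, at least as far away. -/
abbrev Beyond (a c : ℤ) : Prop := (0 < a ∧ a ≤ c) ∨ (a < 0 ∧ c ≤ a)

theorem exists_add_sign_mul_iff (ha : a ≠ 0) : (∃ i : ℕ, c = a + a.sign * i) ↔ Beyond a c := by
  obtain ha | ha := ha.lt_or_gt
  · simp only [Int.sign_eq_neg_one_of_neg ha]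
    exact ⟨fun ⟨i, hi⟩ => by omega, fun h => ⟨(a - c).toNat, by omega⟩⟩
  · simp only [Int.sign_eq_one_of_pos ha]
    exact ⟨fun ⟨i, hi⟩ => by omega, fun h => ⟨(c - a).toNat, by omega⟩⟩

theorem mem_VPlus_iff (hp : p.1 ≠ 0) : q ∈ VPlus p ↔ Beyond p.1 q.1 := by
  rw [← exists_add_sign_mul_iff hp]
  exact exists_congr fun i => ⟨fun ⟨j, hj⟩ => congrArg Prod.fst hj, fun h => ⟨q.2, Prod.ext h rfl⟩⟩

theorem mem_HPlus_iff (hp : p.2 ≠ 0) : q ∈ HPlus p ↔ Beyond p.2 q.2 := by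
  rw [← exists_add_sign_mul_iff hp]
  exact ⟨fun ⟨i, j, hj⟩ => ⟨j, congrArg Prod.snd hj⟩, fun ⟨j, hj⟩ => ⟨q.1, j, Prod.ext rfl hj⟩⟩

theorem exists_isLeast_pos_iff : (∃ a, IsLeast {c : ℤ | 0 < c ∧ P c} a) ↔ ∃ c > 0, P c := by
  refine ⟨fun ⟨a, ha⟩ => ⟨a, ha.1⟩, fun hP => ?_⟩
  obtain ⟨a, ha, hle⟩ := Int.exists_least_of_bdd (P := fun c => 0 < c ∧ P c)
    ⟨0, fun z hz => hz.1.le⟩ hP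
  exact ⟨a, ha, hle⟩

theorem exists_isGreatest_neg_iff : (∃ a, IsGreatest {c : ℤ | c < 0 ∧ P c} a) ↔ ∃ c < 0, P c := by
  refine ⟨fun ⟨a, ha⟩ => ⟨a, ha.1⟩, fun hP => ?_⟩
  obtain ⟨a, ha, hle⟩ := Int.exists_greatest_of_bdd (P := fun c => c < 0 ∧ P c)
    ⟨0, fun z hz => hz.1.le⟩ hP
  exact ⟨a, ha, hle⟩

theorem exists_closest_beyond_iff (hP : ∀ {a c}, P a → Beyond a c → P c) :
    (∃ a, (IsLeast {c : ℤ | 0 < c ∧ P c} a ∨ IsGreatest {c : ℤ | c < 0 ∧ P c} a) ∧ Beyond a c) ↔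
      c ≠ 0 ∧ P c := by
  constructor
  · rintro ⟨a, ha | ha, hc⟩
    · exact ⟨by omega, hP ha.1.2 hc⟩
    · exact ⟨by omega, hP ha.1.2 hc⟩
  · rintro ⟨hc, h⟩
    obtain hc | hc := hc.lt_or_gt
    · obtain ⟨a, ha⟩ := exists_isGreatest_neg_iff.2 ⟨c, hc, h⟩
      exact ⟨a, .inr ha, .inr ⟨ha.1.1, ha.2 ⟨hc, h⟩⟩⟩
    · obtain ⟨a, ha⟩ := exists_isLeast_pos_iff.2 ⟨c, hc, h⟩
      exact ⟨a, .inl ha, .inl ⟨ha.1.1, ha.2 ⟨hc, h⟩⟩⟩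

theorem Reach.of_beyond (h : Reach n u v a b) (hc : Beyond b c) : Reach n u v a c := by
  obtain ⟨hb, hbc⟩ | ⟨hb, hcb⟩ := hc
  · exact h.stretch hb hbc
  · exact reach_neg_right_iff.1 ((reach_neg_right_iff.2 h).stretch (by omega) (by omega))

theorem not_reach_zero_zero (hd : Dirs n u v) (hn : 1 ≤ n) : ¬Reach n u v 0 0 := by
  rintro ⟨x, y, hC, hx, hy⟩
  have := hC.eq_of_end hd n.zero_le (by simp only [hx, hC.startX]; omega)
    (by simp only [hy, hC.startY]; omega)
  omega

theorem mem_iUnion_VPlus_iff :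
    q ∈ ⋃ a ∈ {a : ℤ | IsXPlus σ a ∨ IsXMinus σ a}, VPlus (a, 0) ↔
      q.1 ≠ 0 ∧ (q.1, 0) ∈ reachable σ := by
  rw [← exists_closest_beyond_iff (P := fun c => (c, 0) ∈ reachable σ)]
  · simp only [Set.mem_iUnion, exists_prop]
    refine exists_congr fun a => and_congr_right fun ha => mem_VPlus_iff ?_
    exact ha.elim (fun h => h.1.1.ne') fun h => h.1.1.ne
  · intro a c ha hc
    rw [mem_reachable_iff, ← reach_swap_iff] at ha ⊢
    exact ha.of_beyond hc

theorem mem_iUnion_HPlus_iff :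
    q ∈ ⋃ b ∈ {b : ℤ | IsYPlus σ b ∨ IsYMinus σ b}, HPlus (0, b) ↔
      q.2 ≠ 0 ∧ (0, q.2) ∈ reachable σ := by
  rw [← exists_closest_beyond_iff (P := fun c => (0, c) ∈ reachable σ)]
  · simp only [Set.mem_iUnion, exists_prop]
    refine exists_congr fun b => and_congr_right fun hb => mem_HPlus_iff ?_
    exact hb.elim (fun h => h.1.1.ne') fun h => h.1.1.ne
  · intro b c hb hc
    rw [mem_reachable_iff] at hb ⊢
    exact hb.of_beyond hc

theorem reach_iff_of_hooked (hd : Dirs n u v) (hk : Hooked n u v) :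
    Reach n u v a b ↔ (a ≠ 0 ∧ Reach n u v a 0) ∨ (b ≠ 0 ∧ Reach n u v 0 b) := by
  have hn : 1 ≤ n := by
    obtain ⟨i, hi, -⟩ := hk
    omega
  constructor
  · intro h
    by_cases ha : a = 0
    · subst ha
      exact .inr ⟨fun hb => not_reach_zero_zero hd hn (hb ▸ h), h⟩
    · by_cases hb : b = 0
      · exact .inl ⟨ha, hb ▸ h⟩
      · exact (h.axis hd hk ha hb).imp (⟨ha, ·⟩) (⟨hb, ·⟩)
  · rintro (⟨-, h⟩ | ⟨-, h⟩)
    · exact h.of_axis hd hn b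
    · exact reach_swap_iff.1 ((reach_swap_iff.2 h).of_axis hd.swap hn a)

theorem reachable_of_not_staircase (hs : ¬IsStaircase σ) :
    reachable σ =
      (⋃ a ∈ {a : ℤ | IsXPlus σ a ∨ IsXMinus σ a}, VPlus (a, 0)) ∪
      (⋃ b ∈ {b : ℤ | IsYPlus σ b ∨ IsYMinus σ b}, HPlus (0, b)) := by
  rw [isStaircase_iff, not_not] at hs
  ext ⟨a, b⟩
  rw [Set.mem_union, mem_iUnion_VPlus_iff, mem_iUnion_HPlus_iff]
  simp only [mem_reachable_iff]
  exact reach_iff_of_hooked (dirs_head σ) hs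

theorem reachable_of_length_eq_zero (h : σ.length = 0) :
    reachable σ = {p : ℤ × ℤ | ∃ a : ℤ, 1 ≤ a ∧ p = (a, 0)} := by
  ext ⟨a, b⟩
  rw [mem_reachable_iff, h]
  constructor
  · rintro ⟨x, y, hC, rfl, rfl⟩
    have hx := hC.stepX 0 le_rfl
    have hy := hC.stepY.eq le_rfl (headY_zero σ)
    rw [headX_zero, hC.startX] at hx
    exact ⟨_, by omega, Prod.ext rfl (hy.trans hC.startY)⟩
  · rintro ⟨c, hc, he⟩
    obtain ⟨rfl, rfl⟩ := Prod.mk.inj he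
    refine ⟨fun k => if k = 0 then 0 else a, fun _ => 0, ⟨rfl, rfl, fun i hi => ?_, fun i hi => ?_,
      fun i j hij hj => by omega⟩, rfl, rfl⟩
    · obtain rfl := Nat.le_zero.1 hi
      exact .inr (.inl ⟨headX_zero σ, hc⟩)
    · obtain rfl := Nat.le_zero.1 hi
      exact .inl ⟨headY_zero σ, rfl⟩

theorem mem_QPlus_iff (hp : p.1 ≠ 0) (hp' : p.2 ≠ 0) :
    q ∈ QPlus p ↔ Beyond p.1 q.1 ∧ Beyond p.2 q.2 := by
  rw [QPlus, Set.mem_inter_iff, mem_VPlus_iff hp, mem_HPlus_iff hp']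

theorem reachable_of_left_staircase (hs : IsStaircase σ) (hL : σ.head? = some Turn.L) :
    reachable σ = QPlus (1 + ⌊(σ.length : ℚ) / 2⌋, ⌈(σ.length : ℚ) / 2⌉) := by
  obtain ⟨τ, rfl⟩ := List.head?_eq_some_iff.1 hL
  have hn : 1 ≤ (Turn.L :: τ).length := Nat.le_add_left ..
  ext ⟨a, b⟩
  rw [mem_reachable_iff, floor_half, ceil_half, mem_QPlus_iff (by dsimp only; omega)
    (by dsimp only; omega), reach_iff_of_not_hooked (dirs_head _) hn (isStaircase_iff.1 hs) rfl rfl]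
  dsimp only
  omega

theorem reachable_of_right_staircase (hs : IsStaircase σ) (hR : σ.head? = some Turn.R) :
    reachable σ = QPlus (1 + ⌊(σ.length : ℚ) / 2⌋, -⌈(σ.length : ℚ) / 2⌉) := by
  obtain ⟨τ, rfl⟩ := List.head?_eq_some_iff.1 hR
  have hn : 1 ≤ (Turn.R :: τ).length := Nat.le_add_left ..
  have hk : ¬Hooked (Turn.R :: τ).length (headX (Turn.R :: τ)) (-headY (Turn.R :: τ)) := fun h =>
    isStaircase_iff.1 hs (neg_neg (headY (Turn.R :: τ)) ▸ h.swap.neg_left.swap)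
  ext ⟨a, b⟩
  rw [mem_reachable_iff, floor_half, ceil_half, mem_QPlus_iff (by dsimp only; omega)
    (by dsimp only; omega), ← reach_neg_right_iff,
    reach_iff_of_not_hooked (dirs_head _).swap.neg_left.swap hn hk rfl rfl]
  dsimp only
  omega

theorem exists_reach_neg_iff :
    (∃ a < 0, Reach n u v a 0) ↔ ∃ a > 0, Reach n (-u) v a 0 := by
  constructor
  · rintro ⟨a, ha, h⟩
    exact ⟨-a, by omega, h.neg_left⟩
  · rintro ⟨a, ha, h⟩
    exact ⟨-a, by omega, reach_neg_left_iff.1 (by rwa [neg_neg])⟩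

theorem rightHook_iff (hd : Dirs n u v) : RightHook n u v ↔
    ∃ i, i + 2 ≤ n ∧ (u i = -u (i + 2) ∧ v i = -v (i + 2)) ∧ u (i + 1) = 1 ∧ v (i + 1) = 0 := by
  refine exists_congr fun i => and_congr_right fun hi =>
    ⟨fun ⟨hv, hu⟩ => ?_, fun h => ⟨h.1.2, h.2.1⟩⟩
  have hv1 : v (i + 1) = 0 := by
    have := hd.dir (i + 1) (by omega)
    omega
  have hu0 : u i = 0 := (hd.alt i (by omega)).2 hv1
  have hu2 : u (i + 2) = 0 := (hd.swap.alt (i + 1) (by omega)).1 hv1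
  exact ⟨⟨by rw [hu0, hu2, neg_zero], hv⟩, hu, hv1⟩

theorem exists_isXPlus_iff (hn : 1 ≤ σ.length) : (∃ a, IsXPlus σ a) ↔ HasRightHook σ := by
  have hd := dirs_head σ
  rw [HasRightHook, hasHook_iff, ← rightHook_iff hd, ← exists_reach_iff_rightHook hd hn]
  simp only [IsXPlus, exists_isLeast_pos_iff, mem_reachable_iff]

theorem exists_isXMinus_iff (hn : 1 ≤ σ.length) : (∃ a, IsXMinus σ a) ↔ HasLeftHook σ := by
  have hd := (dirs_head σ).neg_left
  simp only [IsXMinus, exists_isGreatest_neg_iff, mem_reachable_iff]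
  rw [exists_reach_neg_iff, exists_reach_iff_rightHook hd hn, rightHook_iff hd, HasLeftHook,
    hasHook_iff]
  simp only [Pi.neg_apply, neg_eq_iff_eq_neg, neg_neg]

theorem exists_isYPlus_iff (hn : 1 ≤ σ.length) : (∃ b, IsYPlus σ b) ↔ HasUpHook σ := by
  have hd := (dirs_head σ).swap
  simp only [IsYPlus, exists_isLeast_pos_iff, mem_reachable_iff, ← reach_swap_iff (a := 0)]
  rw [exists_reach_iff_rightHook hd hn, rightHook_iff hd, HasUpHook, hasHook_iff]
  exact exists_congr fun i => and_congr_right fun _ => and_congr and_comm and_comm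

theorem exists_isYMinus_iff (hn : 1 ≤ σ.length) : (∃ b, IsYMinus σ b) ↔ HasDownHook σ := by
  have hd := (dirs_head σ).swap.neg_left
  simp only [IsYMinus, exists_isGreatest_neg_iff, mem_reachable_iff, ← reach_swap_iff (a := 0)]
  rw [exists_reach_neg_iff, exists_reach_iff_rightHook hd hn, rightHook_iff hd, HasDownHook,
    hasHook_iff]
  refine exists_congr fun i => and_congr_right fun _ => ?_
  simp only [Pi.neg_apply]
  omega

end Reachable

end TurnSeq

theorem theorem1 (σ : List Turn) :
    (σ.length = 0 → reachable σ = {p : ℤ × ℤ | ∃ a : ℤ, 1 ≤ a ∧ p = (a, 0)}) ∧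
    (IsStaircase σ → σ.head? = some Turn.L →
      reachable σ = QPlus (1 + ⌊(σ.length : ℚ) / 2⌋, ⌈(σ.length : ℚ) / 2⌉)) ∧
    (IsStaircase σ → σ.head? = some Turn.R →
      reachable σ = QPlus (1 + ⌊(σ.length : ℚ) / 2⌋, -⌈(σ.length : ℚ) / 2⌉)) ∧
    (¬ IsStaircase σ →
      reachable σ =
        (⋃ a ∈ {a : ℤ | IsXPlus σ a ∨ IsXMinus σ a}, VPlus (a, 0)) ∪
        (⋃ b ∈ {b : ℤ | IsYPlus σ b ∨ IsYMinus σ b}, HPlus (0, b))) ∧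
    (σ.length ≠ 0 →
      ((∃ a, IsXPlus σ a) ↔ HasRightHook σ) ∧
      ((∃ a, IsXMinus σ a) ↔ HasLeftHook σ) ∧
      ((∃ b, IsYPlus σ b) ↔ HasUpHook σ) ∧
      ((∃ b, IsYMinus σ b) ↔ HasDownHook σ)) := by
  refine ⟨reachable_of_length_eq_zero, reachable_of_left_staircase, reachable_of_right_staircase,
    reachable_of_not_staircase, fun h => ?_⟩
  have hn : 1 ≤ σ.length := Nat.one_le_iff_ne_zero.2 h
  exact ⟨exists_isXPlus_iff hn, exists_isXMinus_iff hn, exists_isYPlus_iff hn,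
    exists_isYMinus_iff hn⟩
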